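/- Let $X$ be any measurable space. For a probability distribution $\mathcal D$ on $X$ and $\eta\in(0,1)$, let $\mathrm{sub}_\eta(\mathcal D)$ be the set of all distributions $\mathcal D'$ that arise as the law of a draw $x\sim\mathcal D$ conditioned on an event $E$ of probability at least $1-\eta$; here $x$ and $E$ live on a common probability space, and $E$ need not be determined by $x$. For a sample $S\in X^M$, let $\mathrm{sub}_\eta(S)$ be the set of all samples formed by removing at most $\lfloor \eta M\rfloor$ arbitrary points from $S$. For a sample $S'$ of at least $n$ points, let $\Phi_{\star\to n}(S')\in X^n$ denote $n$ points drawn (in order) uniformly at random without replacement from $S'$. There is a polynomial $p$ in three variables (independent of $X$, $\mathcal D$ and $f$) such that the following holds. For all $\eta,\varepsilon\in(0,1)$, every $n\in\mathbb N$, every measurable $f:X^n\to\{0,1\}$, every probability distribution $\mathcal D$ on $X$, and every integer $M\ge p\left(n,\tfrac1\varepsilon,\tfrac1{1-\eta}\right)$, one has $M-\lfloor\eta M\rfloor\ge n$ (so that at least $n$ points always remain) and $$\left|\ \sup_{\mathcal D'\in \mathrm{sub}_\eta(\mathcal D)}\ \mathbb E_{S\sim(\mathcal D')^n}\big[f(S)\big]\;-\;\mathbb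 E_{S\sim\mathcal D^M}\Big[\sup_{S'\in\mathrm{sub}_\eta(S)}\mathbb E\big[f(\Phi_{\star\to n}(S'))\big]\Big]\ \right|\ \le\ \varepsilon .$$ -/

import Mathlib

open MeasureTheory ProbabilityTheory

universe u

/-- `subDist η D` is the set of all `η`-subtractive contaminations of the distribution `D`: the laws
of a draw `x ∼ D` conditioned on an event `E` of probability at least `1 - η`. The draw `x` and the
event `E` live on a common probability space `Ω`; the event need not be a function of `x`. -/
def subDist {X : Type u} [MeasurableSpace X] (η : ℝ) (D : Measure X) : Set (Measure X) :=
  {D' | ∃ (Ω : Type u) (_ : MeasurableSpace Ω) (P : Measure Ω) (x : Ω → X) (E : Set Ω),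
    IsProbabilityMeasure P ∧ Measurable x ∧ MeasurableSet E ∧
      P.map x = D ∧ ENNReal.ofReal (1 - η) ≤ P E ∧ D' = (P[|E]).map x}

/-- Samples of arbitrary finite size, `X^⋆`. -/
abbrev Sample (X : Type u) : Type u := Σ k : ℕ, (Fin k → X)

/-- The sample obtained from `S ∈ X^M` by removing the points whose index lies in `R`;
the remaining points keep their order. -/
def removePoints {X : Type u} {M : ℕ} (S : Fin M → X) (R : Finset (Fin M)) : Sample X :=
  ⟨Rᶜ.card, fun j => S (Rᶜ.orderEmbOfFin rfl j)⟩

/-- `subSample η S` is the set of all `η`-subtractive contaminations of the sample `S ∈ X^M`: the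
samples formed by removing at most `⌊η M⌋` arbitrary points from `S`. -/
def subSample {X : Type u} {M : ℕ} (η : ℝ) (S : Fin M → X) : Set (Sample X) :=
  {S' | ∃ R : Finset (Fin M), R.card ≤ ⌊η * M⌋₊ ∧ S' = removePoints S R}

/-- The law of the output of the subsampling filter `Φ_{⋆ → n}` on the input `S`: `n` points drawn
one after the other, uniformly without replacement, from `S`. Equivalently, the points of `S` at the
positions `e 0, …, e (n - 1)` for a uniformly random injection `e` from `Fin n` to the positions
of `S`. (There is no such injection, and this is the zero measure, when `S` has fewer than `n`
points.) -/
noncomputable def subsamplingFilter {X : Type u} [MeasurableSpace X] (n : ℕ) (S : Sample X) :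
    Measure (Fin n → X) :=
  (Fintype.card (Fin n ↪ Fin S.1) : ENNReal)⁻¹ •
    ∑ e : Fin n ↪ Fin S.1, Measure.dirac (fun j => S.2 (e j))

/-- The largest success probability of `f` on `n` i.i.d. points against the oblivious
`η`-subtractive adversary. -/
noncomputable def obliviousSubMax {X : Type u} [MeasurableSpace X] {n : ℕ} (η : ℝ)
    (f : (Fin n → X) → ℝ) (D : Measure X) : ℝ :=
  sSup ((fun D' : Measure X => ∫ S, f S ∂(Measure.pi fun _ : Fin n => D')) '' subDist η D)

/-- The largest success probability of `f ∘ Φ_{⋆ → n}` on a clean sample of `M` i.i.d. points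
that is afterwards corrupted by the adaptive `η`-subtractive adversary. -/
noncomputable def adaptiveSubMax {X : Type u} [MeasurableSpace X] {n : ℕ} (η : ℝ) (M : ℕ)
    (f : (Fin n → X) → ℝ) (D : Measure X) : ℝ :=
  ∫ S, sSup ((fun S' : Sample X => ∫ T, f T ∂(subsamplingFilter n S')) '' subSample η S)
    ∂(Measure.pi fun _ : Fin M => D)

/-!
Write `c = 1 / (1 - η)`. The laws with a density at most `c` with respect to `D` are subtractive
contaminations of `D` (`withDensity_mem_subDist`).

*The oblivious adversary is not stronger* (`integral_pi_le_adaptiveSubMax`). If the oblivious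
adversary conditions on an event `E`, the adaptive one deletes sample points outside `E` as far as
its budget allows. The number of points outside `E` exceeds the budget by `O(√M)` in expectation, so
the `n` subsampled points all lie in `E` up to probability `O(n √M / (M (1 - η)))`. Conditionally on
the set of positions with points in `E`, the points at these positions are i.i.d. with the
conditioned law.

*The adaptive adversary is not stronger* (`integral_embAvg_kept_le`). Fix an optimal rule for the
points to keep, and draw points `W₀, W₁, …` uniformly without replacement from the kept ones. This
sequence is exchangeable, and the adaptive value is the expectation of `f` on any `n` consecutive
terms. The oblivious adversary imitates it by drawing the history `W₀, …, W_{k-1}` itself, and then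
using the conditional law of the next term. Two facts make this work for some `k` of polynomial size.

* The conditional law of the next term given a short history is almost bounded by `c • D`
  (`integral_embAvg_succ_le`). The next term is uniform among the kept points, hence is bounded by
  `c` times a uniform point among all points not drawn so far. These could only be far from `D` if
  the choice of the history conveyed much about them. But the law of the positions of the history is
  at most `exp (2 c k)` times that of uniformly random distinct positions, while the fluctuation of the empirical frequency of
  an event that depends on the history has subgaussian exponential moments
  (`integral_exp_excess_le`); so only the logarithm of that factor enters (`integral_embAvg_excess_le`).

* Given a suitable history the next `n` terms are almost independent
  (`exists_integral_block_le`). The conditional density of a later term given the first `k` terms is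
  a martingale in `k`. Its energy, with the square replaced by a function that is affine beyond `c`,
  increases by at least the squared `L²` distance of the truncated densities and never exceeds
  `2 c`. Hence among `B` consecutive blocks of length `n` there is one on which the density moves by
  at most `√(2 c / B)` in `L¹`, up to the tails (`exists_block_integral_abs_sub_le`). On this block
  the terms are replaced one by one by independent draws (`integral_le_integral_piKernel_add`) from
  the conditional density at the beginning of the block, corrected to be exactly at most `c`
  (`exists_density_le`).

No regularity of `X` is needed, since all conditional laws are given by densities with respect
to `D`.
-/

/-! ### Averages over injections -/

/-- The average of `F` over the uniformly random injections of `Fin k` into the finite set `C`,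
each regarded as an injection into the ambient type. It is `0` when `C` has fewer than `k`
elements. -/
noncomputable def embAvg {α : Type*} (C : Finset α) (k : ℕ) (F : (Fin k ↪ α) → ℝ) : ℝ :=
  (Fintype.card (Fin k ↪ C) : ℝ)⁻¹ *
    ∑ e : Fin k ↪ C, F (e.trans (Function.Embedding.subtype (· ∈ C)))

section embAvg

variable {α : Type*} {C : Finset α} {k : ℕ}

lemma card_fin_embedding (C : Finset α) (k : ℕ) :
    Fintype.card (Fin k ↪ C) = C.card.descFactorial k := by
  simp [Fintype.card_embedding_eq]

lemma embAvg_mono {F G : (Fin k ↪ α) → ℝ}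
    (h : ∀ e : Fin k ↪ α, (∀ i, e i ∈ C) → F e ≤ G e) : embAvg C k F ≤ embAvg C k G := by
  unfold embAvg
  gcongr with e
  exact h _ fun i => (e i).2

lemma embAvg_const (hk : k ≤ C.card) (c : ℝ) : embAvg C k (fun _ => c) = c := by
  have h : (Fintype.card (Fin k ↪ C) : ℝ) ≠ 0 := by
    rw [card_fin_embedding]
    exact_mod_cast (Nat.descFactorial_pos.2 hk).ne'
  rw [embAvg, Finset.sum_const, Finset.card_univ, nsmul_eq_mul, inv_mul_cancel_left₀ h]

lemma embAvg_add (F G : (Fin k ↪ α) → ℝ) :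
    embAvg C k (fun e => F e + G e) = embAvg C k F + embAvg C k G := by
  simp [embAvg, Finset.sum_add_distrib, mul_add]

lemma embAvg_const_mul (c : ℝ) (F : (Fin k ↪ α) → ℝ) :
    embAvg C k (fun e => c * F e) = c * embAvg C k F := by
  simp only [embAvg, ← Finset.mul_sum]; ring

lemma embAvg_mem_Icc {F : (Fin k ↪ α) → ℝ} (hk : k ≤ C.card) {a b : ℝ}
    (h : ∀ e, F e ∈ Set.Icc a b) : embAvg C k F ∈ Set.Icc a b := by
  constructor
  · rw [← embAvg_const hk a]; exact embAvg_mono fun e _ => (h e).1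
  · rw [← embAvg_const hk b]; exact embAvg_mono fun e _ => (h e).2

/-- Dropping the constraint that the injection takes values in `C` costs at most the inverse of the
number of injections into a set with `m ≤ #C` elements. -/
lemma embAvg_le_sum [Fintype α] {F : (Fin k ↪ α) → ℝ} (hF : ∀ e, 0 ≤ F e) {m : ℕ} (hk : k ≤ m)
    (hm : m ≤ C.card) :
    embAvg C k F ≤ (m.descFactorial k : ℝ)⁻¹ * ∑ e : Fin k ↪ α, F e := by
  have h0 : (0 : ℝ) < m.descFactorial k := by exact_mod_cast Nat.descFactorial_pos.2 hk
  unfold embAvg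
  rw [card_fin_embedding]
  gcongr
  · exact Finset.sum_nonneg fun e _ => hF _
  · let i : (Fin k ↪ C) → (Fin k ↪ α) := fun e => e.trans (Function.Embedding.subtype (· ∈ C))
    have hi : Function.Injective i := by
      intro e e' h
      ext j
      exact congrArg (fun a : Fin k ↪ α => a j) h
    calc ∑ e, F (i e) = ∑ e ∈ Finset.univ.map ⟨i, hi⟩, F e := by simp
      _ ≤ _ := Finset.sum_le_univ_sum_of_nonneg hF

/-- Any two injections of `Fin j` into a finite type are extended by equally many injections of
`Fin k`, because a permutation of the target carries one to the other. -/
lemma card_filter_trans_eq {β : Type*} [Fintype β] {j k : ℕ} (ι : Fin j ↪ Fin k)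
    [DecidableEq (Fin j ↪ β)] (e₁ e₂ : Fin j ↪ β) :
    (Finset.univ.filter fun e : Fin k ↪ β => ι.trans e = e₁).card =
      (Finset.univ.filter fun e : Fin k ↪ β => ι.trans e = e₂).card := by
  classical
  obtain ⟨σ, hσ⟩ := Equiv.Perm.exists_extending_pair e₁ e₂ e₁.injective e₂.injective
  have hσ' : e₁.trans σ.toEmbedding = e₂ := by ext i; exact hσ i
  refine Finset.card_bij' (fun e _ => e.trans σ.toEmbedding)
    (fun e _ => e.trans σ.symm.toEmbedding) ?_ ?_ ?_ ?_
  · intro e he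
    simp only [Finset.mem_filter, Finset.mem_univ, true_and] at he ⊢
    rw [← hσ', ← he]; rfl
  · intro e he
    simp only [Finset.mem_filter, Finset.mem_univ, true_and] at he ⊢
    ext i
    have := congrArg (fun a : Fin j ↪ β => σ.symm (a i)) (he.trans hσ'.symm)
    simpa using this
  · intro e _; ext i; simp
  · intro e _; ext i; simp

/-- A restriction of a uniformly random injection is a uniformly random injection. -/
lemma embAvg_trans {j k : ℕ} (ι : Fin j ↪ Fin k) (hk : k ≤ C.card) (F : (Fin j ↪ α) → ℝ) :
    embAvg C k (fun e => F (ι.trans e)) = embAvg C j F := by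
  classical
  have hjk : j ≤ k := by simpa using Fintype.card_le_of_embedding ι
  obtain ⟨e₀⟩ : Nonempty (Fin j ↪ C) :=
    Function.Embedding.nonempty_of_card_le (by simpa using hjk.trans hk)
  set c := (Finset.univ.filter fun e : Fin k ↪ C => ι.trans e = e₀).card with hc
  have key : ∀ G : (Fin j ↪ C) → ℝ, ∑ e : Fin k ↪ C, G (ι.trans e) = c * ∑ e, G e := by
    intro G
    rw [← Finset.sum_fiberwise Finset.univ (fun e : Fin k ↪ C => ι.trans e), Finset.mul_sum]
    refine Finset.sum_congr rfl fun e' _ => ?_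
    rw [Finset.sum_congr rfl (g := fun _ => G e')
      (fun e he => by rw [(Finset.mem_filter.1 he).2]), Finset.sum_const,
      card_filter_trans_eq ι e' e₀, nsmul_eq_mul]
  have h1 := key (fun _ => 1)
  simp only [Finset.sum_const, Finset.card_univ, nsmul_eq_mul, mul_one] at h1
  have hpos : (0 : ℝ) < Fintype.card (Fin k ↪ C) := by
    rw [card_fin_embedding]; exact_mod_cast Nat.descFactorial_pos.2 hk
  have hc0 : (c : ℝ) ≠ 0 := by
    intro h; rw [h, zero_mul] at h1; exact hpos.ne' h1
  have h2 := key (fun e => F (e.trans (Function.Embedding.subtype (· ∈ C))))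
  have h3 : ∑ e : Fin k ↪ C, F (ι.trans (e.trans (Function.Embedding.subtype (· ∈ C)))) =
      c * ∑ e : Fin j ↪ C, F (e.trans (Function.Embedding.subtype (· ∈ C))) := h2
  unfold embAvg
  rw [h3, h1, mul_inv]
  field_simp

/-- One step of sampling without replacement: given the first `k` elements, the next one is uniform
among at least `m - k` elements, so that its average is at most a sum over all unused elements of
the ambient type, divided by `m - k`. -/
lemma embAvg_succ_le [Fintype α] [DecidableEq α] {H : (Fin k ↪ α) → α → ℝ}
    (hH : ∀ e a, 0 ≤ H e a) {m : ℕ} (hk : k < m) (hm : m ≤ C.card) :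
    embAvg C (k + 1) (fun e => H ((Fin.succEmb k).trans e) (e 0)) ≤
      ((m : ℝ) - k)⁻¹ *
        embAvg C k (fun e => ∑ a ∈ Finset.univ.filter (fun a => ∀ i, e i ≠ a), H e a) := by
  classical
  have hmk : (0 : ℝ) < (m : ℝ) - k := by
    rw [sub_pos]; exact_mod_cast hk
  have hCk : ((m : ℝ) - k) ≤ (C.card : ℝ) - k := by
    have : (m : ℝ) ≤ C.card := by exact_mod_cast hm
    linarith
  have hcard : (Fintype.card (Fin (k + 1) ↪ C) : ℝ) =
      ((C.card : ℝ) - k) * Fintype.card (Fin k ↪ C) := by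
    rw [card_fin_embedding, card_fin_embedding, Nat.descFactorial_succ, Nat.cast_mul,
      Nat.cast_sub (by omega)]
  have hsum : ∑ e : Fin (k + 1) ↪ C,
        H ((Fin.succEmb k).trans (e.trans (Function.Embedding.subtype (· ∈ C))))
          (e 0 : α) ≤
      ∑ e : Fin k ↪ C, ∑ a ∈ Finset.univ.filter
        (fun a => ∀ i, (e.trans (Function.Embedding.subtype (· ∈ C))) i ≠ a),
          H (e.trans (Function.Embedding.subtype (· ∈ C))) a := by
    rw [← (Equiv.embeddingFinSucc k C).symm.sum_comp, Fintype.sum_sigma]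
    gcongr with e
    set e' : Fin k ↪ α := e.trans (Function.Embedding.subtype (· ∈ C)) with he'
    calc ∑ y : {i : C // i ∉ Set.range e}, H _ _
        = ∑ y : {i : C // i ∉ Set.range e}, H e' (y.1 : α) := by
          refine Finset.sum_congr rfl fun y _ => ?_
          congr 1
      _ = ∑ a ∈ Finset.univ.map ⟨fun y : {i : C // i ∉ Set.range e} => (y.1 : α),
            fun y y' h => Subtype.ext (Subtype.ext h)⟩, H e' a := by rw [Finset.sum_map]; rfl
      _ ≤ _ := by
          refine Finset.sum_le_sum_of_subset_of_nonneg ?_ fun a _ _ => hH _ _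
          intro a ha
          simp only [Finset.mem_map, Finset.mem_univ, true_and] at ha
          obtain ⟨y, rfl⟩ := ha
          simp only [Finset.mem_filter, Finset.mem_univ, true_and]
          intro i hi
          exact y.2 ⟨i, Subtype.ext hi⟩
  unfold embAvg
  rw [hcard, mul_inv, mul_assoc]
  have hnn : (0 : ℝ) ≤ (Fintype.card (Fin k ↪ C) : ℝ)⁻¹ := by positivity
  refine mul_le_mul (inv_anti₀ hmk hCk) (mul_le_mul_of_nonneg_left hsum hnn) ?_ (by positivity)
  exact mul_nonneg hnn (Finset.sum_nonneg fun e _ => hH _ _)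

end embAvg

/-- The subsampling filter applied to a sample from which the points in `R` have been removed
averages over the injections into the set of the remaining positions. -/
lemma integral_subsamplingFilter_removePoints {X : Type u} [MeasurableSpace X] {M n : ℕ}
    {f : (Fin n → X) → ℝ} (hf : Measurable f) (S : Fin M → X) (R : Finset (Fin M)) :
    ∫ T, f T ∂(subsamplingFilter n (removePoints S R)) = embAvg Rᶜ n (fun e => f (S ∘ e)) := by
  unfold subsamplingFilter embAvg
  rw [integral_smul_measure, integral_finsetSum_measure
    (fun e _ => integrable_dirac' hf.stronglyMeasurable (by simp))]
  simp only [integral_dirac' _ _ hf.stronglyMeasurable, removePoints, smul_eq_mul]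
  congr 1
  · rw [ENNReal.toReal_inv, ENNReal.toReal_natCast]
    exact congrArg (fun c : ℕ => (c : ℝ)⁻¹) (Fintype.card_congr
      (Equiv.embeddingCongr (Equiv.refl (Fin n)) (Rᶜ.orderIsoOfFin rfl).toEquiv))
  · rw [← (Equiv.embeddingCongr (Equiv.refl (Fin n)) (Rᶜ.orderIsoOfFin rfl).toEquiv).sum_comp]
    refine Finset.sum_congr rfl fun e _ => ?_
    congr 1

/-! ### Product measures -/

section Pi

variable {ι κ : Type*} {X : Type*} [MeasurableSpace X]

/-- The point that agrees with `S` on the coordinates satisfying `p` and with `S'` elsewhere. -/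
def mixCoord (p : ι → Prop) [DecidablePred p] (S S' : ι → X) : ι → X :=
  fun i => if p i then S i else S' i

lemma measurable_mixCoord (p : ι → Prop) [DecidablePred p] :
    Measurable fun q : (ι → X) × (ι → X) => mixCoord p q.1 q.2 := by
  refine measurable_pi_lambda _ fun i => ?_
  unfold mixCoord
  split_ifs <;> fun_prop

variable [Fintype ι] [Fintype κ]

/-- Distinct coordinates of an i.i.d. sample are again an i.i.d. sample. -/
lemma pi_map_comp_injective (D : Measure X) [IsProbabilityMeasure D] {e : κ → ι}
    (he : Function.Injective e) :
    (Measure.pi fun _ : ι => D).map (fun S => S ∘ e) = Measure.pi fun _ : κ => D := by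
  have := Measure.map_infinitePi_infinitePi_of_inj (P := fun _ : ι => D) he
  rwa [Measure.infinitePi_eq_pi, Measure.infinitePi_eq_pi] at this

/-- Replacing some coordinates of an i.i.d. sample by those of an independent copy does not change
its law. -/
lemma measurePreserving_mixCoord (D : Measure X) [IsProbabilityMeasure D] (p : ι → Prop)
    [DecidablePred p] :
    MeasurePreserving (fun q : (ι → X) × (ι → X) => mixCoord p q.1 q.2)
      ((Measure.pi fun _ : ι => D).prod (Measure.pi fun _ : ι => D))
      (Measure.pi fun _ : ι => D) := by
  refine ⟨measurable_mixCoord p, (Measure.pi_eq fun t ht => ?_).symm⟩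
  rw [Measure.map_apply (measurable_mixCoord p) (.univ_pi ht)]
  have : (fun q : (ι → X) × (ι → X) => mixCoord p q.1 q.2) ⁻¹' Set.univ.pi t =
      (Set.univ.pi fun i => if p i then t i else Set.univ) ×ˢ
        (Set.univ.pi fun i => if p i then Set.univ else t i) := by
    ext ⟨S, S'⟩
    simp only [Set.mem_preimage, Set.mem_univ_pi, Set.mem_prod, mixCoord, ← forall_and]
    refine forall_congr' fun i => ?_
    by_cases h : p i <;> simp [h]
  rw [this, Measure.prod_prod, Measure.pi_pi, Measure.pi_pi, ← Finset.prod_mul_distrib]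
  refine Finset.prod_congr rfl fun i _ => ?_
  by_cases h : p i <;> simp [h]

lemma integral_mixCoord (D : Measure X) [IsProbabilityMeasure D] (p : ι → Prop)
    [DecidablePred p] {h : (ι → X) → ℝ} (hm : Measurable h)
    (hi : Integrable h (Measure.pi fun _ : ι => D)) :
    ∫ S, h S ∂(Measure.pi fun _ : ι => D) =
      ∫ S, ∫ S', h (mixCoord p S S') ∂(Measure.pi fun _ : ι => D)
        ∂(Measure.pi fun _ : ι => D) := by
  have hmp := measurePreserving_mixCoord (ι := ι) D p
  rw [integral_integral (f := fun S S' => h (mixCoord p S S'))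
    ((hmp.integrable_comp hi.aestronglyMeasurable).2 hi)]
  conv_lhs => rw [← hmp.map_eq]
  rw [integral_map hmp.measurable.aemeasurable hm.aestronglyMeasurable]

/-- The kernel whose value at `a` is the law of a family of independent draws from `κ a`. -/
noncomputable def piKernel {Ω : Type*} [MeasurableSpace Ω] (ι : Type*) [Fintype ι]
    (κ : Kernel Ω X) [IsMarkovKernel κ] : Kernel Ω (ι → X) where
  toFun a := Measure.pi fun _ : ι => κ a
  measurable' := by
    refine Measurable.measure_of_isPiSystem_of_isProbabilityMeasure generateFrom_pi.symm
      isPiSystem_pi ?_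
    rintro _ ⟨t, ht, rfl⟩
    simp only [Measure.pi_pi]
    exact Finset.measurable_prod _ fun i _ => κ.measurable_coe (ht i (Set.mem_univ i))

lemma piKernel_apply {Ω : Type*} [MeasurableSpace Ω] (κ : Kernel Ω X) [IsMarkovKernel κ] (a : Ω) :
    piKernel ι κ a = Measure.pi fun _ : ι => κ a := rfl

instance {Ω : Type*} [MeasurableSpace Ω] (κ : Kernel Ω X) [IsMarkovKernel κ] :
    IsMarkovKernel (piKernel ι κ) := ⟨fun a => by rw [piKernel_apply]; infer_instance⟩

end Pi

lemma integrable_of_mem_Icc' {Y : Type*} [MeasurableSpace Y] {μ : Measure Y} [IsFiniteMeasure μ]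
    {f : Y → ℝ} (hf : Measurable f) {a b : ℝ} (h : ∀ y, f y ∈ Set.Icc a b) : Integrable f μ :=
  Integrable.of_mem_Icc a b hf.aemeasurable (Filter.Eventually.of_forall h)

lemma integral_mem_Icc {Y : Type*} [MeasurableSpace Y] {μ : Measure Y} [IsProbabilityMeasure μ]
    {f : Y → ℝ} (hf : Measurable f) {a b : ℝ} (h : ∀ y, f y ∈ Set.Icc a b) :
    ∫ y, f y ∂μ ∈ Set.Icc a b := by
  have hi := integrable_of_mem_Icc' (μ := μ) hf h
  constructor
  · have := integral_mono (integrable_const (μ := μ) a) hi fun y => (h y).1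
    simpa using this
  · have := integral_mono hi (integrable_const (μ := μ) b) fun y => (h y).2
    simpa using this

/-! ### An energy increment argument for martingales of densities -/

/-- The Radon-Nikodym derivative at a coarser level: for `ρ ≪ ν` and a measurable map `p`, the
density of the image measures, which integrates functions of `p` correctly. -/
lemma exists_density_comp {Y Y' : Type*} [MeasurableSpace Y] [MeasurableSpace Y']
    {ρ ν : Measure Y} [IsFiniteMeasure ρ] [IsFiniteMeasure ν] (hac : ρ ≪ ν) {p : Y → Y'}
    (hp : Measurable p) :
    ∃ V : Y' → ℝ, Measurable V ∧ (∀ y, 0 ≤ V y) ∧ Integrable (fun y => V (p y)) ν ∧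
      ∀ ψ : Y' → ℝ, Measurable ψ → ∫ y, V (p y) * ψ (p y) ∂ν = ∫ y, ψ (p y) ∂ρ := by
  have hac' : ρ.map p ≪ ν.map p := hac.map hp
  have hV : Measurable fun y => ((ρ.map p).rnDeriv (ν.map p) y).toReal :=
    (Measure.measurable_rnDeriv _ _).ennreal_toReal
  refine ⟨_, hV, fun y => ENNReal.toReal_nonneg, ?_, fun ψ hψ => ?_⟩
  · have := (Measure.integrable_toReal_rnDeriv (μ := ρ.map p) (ν := ν.map p))
    exact (integrable_map_measure hV.aestronglyMeasurable hp.aemeasurable).1 this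
  · rw [← integral_map hp.aemeasurable hψ.aestronglyMeasurable,
      ← integral_toReal_rnDeriv_mul hac', integral_map hp.aemeasurable]
    exact (hV.mul hψ).aestronglyMeasurable

lemma integral_abs_le_sqrt {Y : Type*} [MeasurableSpace Y] {ν : Measure Y}
    [IsProbabilityMeasure ν] {h : Y → ℝ} (hi : Integrable h ν)
    (hi2 : Integrable (fun y => h y ^ 2) ν) : ∫ y, |h y| ∂ν ≤ √(∫ y, h y ^ 2 ∂ν) := by
  refine Real.le_sqrt_of_sq_le ?_
  set c := ∫ y, |h y| ∂ν with hc
  have h1 : ∫ y, (2 * c * |h y| - c ^ 2) ∂ν ≤ ∫ y, h y ^ 2 ∂ν := by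
    refine integral_mono ((hi.abs.const_mul _).sub (integrable_const _)) hi2 fun y => ?_
    have := sq_nonneg (|h y| - c)
    simp only
    rw [← sq_abs (h y)]
    linarith
  rw [integral_sub (hi.abs.const_mul _) (integrable_const _), integral_const_mul, ← hc] at h1
  simp at h1
  linarith

/-- The Bregman divergence of the function that is `u ^ 2` for `u ≤ C` and affine beyond `C`
dominates the squared distance of the truncations at `C`. -/
lemma sq_min_sub_min_le (u u' C : ℝ) :
    (min u' C - min u C) ^ 2 ≤
      (min u' C ^ 2 + 2 * C * (u' - min u' C)) - (min u C ^ 2 + 2 * C * (u - min u C)) -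
        2 * (min u C * (u' - u)) := by
  rcases le_total u C with h | h <;> rcases le_total u' C with h' | h' <;>
    simp only [min_eq_left, min_eq_right, h, h'] <;> nlinarith

lemma min_const_mem_Icc {u C : ℝ} (hC : 0 ≤ C) (hu : 0 ≤ u) : min u C ∈ Set.Icc 0 C :=
  ⟨le_min hu hC, min_le_right _ _⟩

/-- The energy `∫ φ ∘ v`, where `φ u = u ^ 2` for `u ≤ C` and `φ` is affine beyond `C`. -/
noncomputable def energy {Y : Type*} [MeasurableSpace Y] (ν : Measure Y) (C : ℝ) (v : Y → ℝ) : ℝ :=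
  ∫ y, (min (v y) C ^ 2 + 2 * C * (v y - min (v y) C)) ∂ν

lemma energy_nonneg {Y : Type*} [MeasurableSpace Y] {ν : Measure Y} {C : ℝ} {v : Y → ℝ} (hC : 0 ≤ C) : 0 ≤ energy ν C v := by
  refine integral_nonneg fun y => ?_
  have : min (v y) C ≤ v y := min_le_left _ _
  have : 0 ≤ C * (v y - min (v y) C) := mul_nonneg hC (by linarith)
  simp only [Pi.zero_apply]
  nlinarith [sq_nonneg (min (v y) C)]

section Energy

variable {Y : Type*} [MeasurableSpace Y] {ν : Measure Y} [IsProbabilityMeasure ν]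

variable {C : ℝ} {v w : Y → ℝ}

lemma integrable_min_const (hv : Integrable v ν) : Integrable (fun y => min (v y) C) ν :=
  hv.inf (integrable_const C)

lemma integrable_min_const_sq (hC : 0 ≤ C) (hv : Integrable v ν) (hv0 : ∀ y, 0 ≤ v y) :
    Integrable (fun y => min (v y) C ^ 2) ν := by
  refine Integrable.of_mem_Icc 0 (C ^ 2) ((integrable_min_const hv).aemeasurable.pow_const 2)
    (Filter.Eventually.of_forall fun y => ?_)
  obtain ⟨h1, h2⟩ := min_const_mem_Icc hC (hv0 y)
  exact ⟨by positivity, by gcongr⟩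

lemma integrable_energy (hC : 0 ≤ C) (hv : Integrable v ν) (hv0 : ∀ y, 0 ≤ v y) :
    Integrable (fun y => min (v y) C ^ 2 + 2 * C * (v y - min (v y) C)) ν :=
  (integrable_min_const_sq hC hv hv0).add ((hv.sub (integrable_min_const hv)).const_mul _)

lemma energy_le (hC : 0 ≤ C) (hv : Integrable v ν) (hv0 : ∀ y, 0 ≤ v y)
    (hv1 : ∫ y, v y ∂ν = 1) : energy ν C v ≤ 2 * C := by
  have h : energy ν C v ≤ ∫ y, 2 * C * v y ∂ν := by
    refine integral_mono (integrable_energy hC hv hv0) (hv.const_mul _) fun y => ?_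
    obtain ⟨h1, h2⟩ := min_const_mem_Icc hC (hv0 y)
    simp only
    nlinarith
  rwa [integral_const_mul, hv1, mul_one] at h

/-- The energy increment between two densities of which the second has the first as its
conditional expectation; only orthogonality to the truncation of the first is used. -/
lemma integral_sq_min_sub_min_le (hC : 0 ≤ C) (hv : Integrable v ν) (hv0 : ∀ y, 0 ≤ v y)
    (hw : Integrable w ν) (hw0 : ∀ y, 0 ≤ w y)
    (horth : ∫ y, min (v y) C * (w y - v y) ∂ν = 0) :
    Integrable (fun y => (min (w y) C - min (v y) C) ^ 2) ν ∧
    ∫ y, (min (w y) C - min (v y) C) ^ 2 ∂ν ≤ energy ν C w - energy ν C v := by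
  have hi : Integrable (fun y => (min (w y) C - min (v y) C) ^ 2) ν := by
    refine Integrable.of_mem_Icc 0 (C ^ 2)
      (((integrable_min_const hw).sub (integrable_min_const hv)).aemeasurable.pow_const 2)
      (Filter.Eventually.of_forall fun y => ?_)
    obtain ⟨h1, h2⟩ := min_const_mem_Icc hC (hv0 y)
    obtain ⟨h3, h4⟩ := min_const_mem_Icc hC (hw0 y)
    exact ⟨by positivity, sq_le_sq' (by linarith) (by linarith)⟩
  refine ⟨hi, ?_⟩
  have hio : Integrable (fun y => min (v y) C * (w y - v y)) ν := by
    refine (hw.sub hv).bdd_mul (c := C) (integrable_min_const hv).aestronglyMeasurable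
      (Filter.Eventually.of_forall fun y => ?_)
    obtain ⟨h1, h2⟩ := min_const_mem_Icc hC (hv0 y)
    rw [Real.norm_eq_abs, abs_of_nonneg h1]; exact h2
  have hew := integrable_energy hC hw hw0
  have hev := integrable_energy hC hv hv0
  have hd : Integrable (fun y => (min (w y) C ^ 2 + 2 * C * (w y - min (w y) C)) -
      (min (v y) C ^ 2 + 2 * C * (v y - min (v y) C))) ν := hew.sub hev
  calc ∫ y, (min (w y) C - min (v y) C) ^ 2 ∂ν
      ≤ ∫ y, ((min (w y) C ^ 2 + 2 * C * (w y - min (w y) C)) -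
          (min (v y) C ^ 2 + 2 * C * (v y - min (v y) C)) -
          2 * (min (v y) C * (w y - v y))) ∂ν :=
        integral_mono hi ((hew.sub hev).sub (hio.const_mul 2)) fun y => sq_min_sub_min_le _ _ _
    _ = energy ν C w - energy ν C v := by
        rw [integral_sub hd (hio.const_mul 2), integral_sub hew hev,
          integral_const_mul, horth, mul_zero, sub_zero]
        rfl

/-- A martingale of densities that are essentially bounded by `C` is nearly constant in `L¹` on one
of `B` consecutive blocks of length `n`, because its energy increases and is at most `2 * C`. -/
lemma exists_block_integral_abs_sub_le {v : ℕ → Y → ℝ} (hC : 0 ≤ C)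
    (hv : ∀ k, Integrable (v k) ν) (hv0 : ∀ k y, 0 ≤ v k y) (hv1 : ∀ k, ∫ y, v k y ∂ν = 1)
    {N n B : ℕ} {δ : ℝ} (hB : 0 < B) (hN : B * n ≤ N)
    (horth : ∀ k l, k ≤ l → l ≤ N → ∫ y, min (v k y) C * (v l y - v k y) ∂ν = 0)
    (htail : ∀ k ≤ N, ∫ y, (v k y - min (v k y) C) ∂ν ≤ δ) :
    ∃ k, k + n ≤ N ∧ ∀ j ≤ n, ∫ y, |v (k + j) y - v k y| ∂ν ≤ 2 * δ + √(2 * C / B) := by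
  have hsq := fun k l (hkl : k ≤ l) (hl : l ≤ N) =>
    integral_sq_min_sub_min_le hC (hv k) (hv0 k) (hv l) (hv0 l) (horth k l hkl hl)
  have hmono : ∀ k l, k ≤ l → l ≤ N → energy ν C (v k) ≤ energy ν C (v l) := by
    intro k l hkl hl
    have h1 := (hsq k l hkl hl).2
    have h2 : 0 ≤ ∫ y, (min (v l y) C - min (v k y) C) ^ 2 ∂ν :=
      integral_nonneg fun y => sq_nonneg _
    linarith
  have hsum : ∑ b ∈ Finset.range B,
      (energy ν C (v ((b + 1) * n)) - energy ν C (v (b * n))) ≤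
        ∑ _b ∈ Finset.range B, 2 * C / B := by
    rw [Finset.sum_range_sub (fun b => energy ν C (v (b * n))) B, Finset.sum_const,
      Finset.card_range, nsmul_eq_mul, mul_div_cancel₀ _ (by positivity)]
    have h1 := energy_le hC (hv (B * n)) (hv0 _) (hv1 _)
    have h2 := energy_nonneg (ν := ν) (v := v (0 * n)) hC
    linarith
  obtain ⟨b, hb, hle⟩ := Finset.exists_le_of_sum_le (by simpa using hB.ne') hsum
  rw [Finset.mem_range] at hb
  have hbN : b * n + n ≤ N := by
    calc b * n + n = (b + 1) * n := by ring
      _ ≤ B * n := by gcongr; omega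
      _ ≤ N := hN
  refine ⟨b * n, hbN, fun j hj => ?_⟩
  obtain ⟨hi2, hE⟩ := hsq (b * n) (b * n + j) (by omega) (by omega)
  have hE' : ∫ y, (min (v (b * n + j) y) C - min (v (b * n) y) C) ^ 2 ∂ν ≤ 2 * C / B := by
    have := hmono (b * n + j) ((b + 1) * n) (by nlinarith) (by nlinarith)
    linarith
  have hm := fun k => integrable_min_const (C := C) (hv k)
  have h1 := integral_abs_le_sqrt ((hm (b * n + j)).sub (hm (b * n))) hi2
  have h2 := Real.sqrt_le_sqrt hE'
  have hd : ∀ k, Integrable (fun y => v k y - min (v k y) C) ν := fun k => (hv k).sub (hm k)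
  have hd2 : Integrable (fun y => (v (b * n + j) y - min (v (b * n + j) y) C) +
      (v (b * n) y - min (v (b * n) y) C)) ν := (hd _).add (hd _)
  have ha : Integrable (fun y => |min (v (b * n + j) y) C - min (v (b * n) y) C|) ν :=
    ((hm _).sub (hm _)).abs
  have h3 : ∫ y, |v (b * n + j) y - v (b * n) y| ∂ν ≤
      ∫ y, ((v (b * n + j) y - min (v (b * n + j) y) C) +
        (v (b * n) y - min (v (b * n) y) C) +
        |min (v (b * n + j) y) C - min (v (b * n) y) C|) ∂ν := by
    refine integral_mono ((hv _).sub (hv _)).abs (hd2.add ha) fun y => ?_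
    have e1 : min (v (b * n + j) y) C ≤ v (b * n + j) y := min_le_left _ _
    have e2 : min (v (b * n) y) C ≤ v (b * n) y := min_le_left _ _
    simp only
    rcases abs_cases (min (v (b * n + j) y) C - min (v (b * n) y) C) with h | h <;>
    rcases abs_cases (v (b * n + j) y - v (b * n) y) with h' | h' <;> linarith
  rw [integral_add hd2 ha, integral_add (hd _) (hd _)] at h3
  have h4 := htail (b * n + j) (by omega)
  have h5 := htail (b * n) (by omega)
  simp only [Pi.sub_apply] at h1
  linarith

end Energy

/-! ### Approximation by conditionally independent draws -/

section Fill

variable {Ω X : Type*} [MeasurableSpace Ω] [MeasurableSpace X]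

/-- A measurable family of nonnegative functions, truncated at `C > 1`, can be turned into a family
of probability densities bounded by `C` by moving only the missing or excess mass: a deficit is
filled proportionally to the room left below `C`, an excess is scaled away. -/
lemma exists_density_le (D : Measure X) [IsProbabilityMeasure D] {C : ℝ} (hC : 1 < C)
    {V : Ω × X → ℝ} (hV : Measurable V) (hV0 : ∀ z, 0 ≤ V z) :
    ∃ r : Ω × X → ℝ, Measurable r ∧ (∀ z, r z ∈ Set.Icc 0 C) ∧ (∀ s, ∫ x, r (s, x) ∂D = 1) ∧
      ∀ s, ∫ x, |r (s, x) - min (V (s, x)) C| ∂D ≤ |1 - ∫ x, min (V (s, x)) C ∂D| := by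
  set w : Ω × X → ℝ := fun z => min (V z) C with hw
  set a : Ω → ℝ := fun s => ∫ x, w (s, x) ∂D with ha
  have hwm : Measurable w := hV.min measurable_const
  have ham : Measurable a := hwm.stronglyMeasurable.integral_prod_right.measurable
  have hwI : ∀ z, w z ∈ Set.Icc 0 C := fun z => min_const_mem_Icc (by linarith) (hV0 z)
  have hwi : ∀ s, Integrable (fun x => w (s, x)) D := fun s =>
    integrable_of_mem_Icc' (by fun_prop) fun x => hwI (s, x)
  have ha0 : ∀ s, 0 ≤ a s := fun s => integral_nonneg fun x => (hwI _).1
  have hup : ∀ s, ∫ x, (C - w (s, x)) ∂D = C - a s := fun s => by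
    rw [integral_sub (integrable_const _) (hwi s)]; simp [ha]
  set r : Ω × X → ℝ := fun z => if a z.1 ≤ 1 then w z + (1 - a z.1) / (C - a z.1) * (C - w z)
    else (a z.1)⁻¹ * w z with hr
  refine ⟨r, ?_, fun z => ?_, fun s => ?_, fun s => ?_⟩
  · refine Measurable.ite (measurableSet_le (by fun_prop) measurable_const) ?_ ?_ <;> fun_prop
  · obtain ⟨h1, h2⟩ := hwI z
    by_cases h : a z.1 ≤ 1
    · simp only [hr, h, if_true]
      have hc0 : 0 ≤ (1 - a z.1) / (C - a z.1) := div_nonneg (by linarith) (by linarith)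
      have hc1 : (1 - a z.1) / (C - a z.1) ≤ 1 := by
        rw [div_le_one (by linarith)]; linarith
      constructor
      · have := mul_nonneg hc0 (sub_nonneg.2 h2); linarith
      · have := mul_le_mul_of_nonneg_right hc1 (sub_nonneg.2 h2); linarith
    · simp only [hr, h, if_false]
      push Not at h
      have hc : (a z.1)⁻¹ ≤ 1 := inv_le_one_of_one_le₀ h.le
      have hc0 : 0 ≤ (a z.1)⁻¹ := inv_nonneg.2 (ha0 _)
      exact ⟨by positivity, by nlinarith⟩
  · by_cases h : a s ≤ 1
    · simp only [hr, h, if_true]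
      have hi : Integrable (fun x => C - w (s, x)) D := (integrable_const C).sub (hwi s)
      rw [integral_add (hwi s) (hi.const_mul _), integral_const_mul, hup s,
        div_mul_cancel₀ _ (by linarith)]
      simp [ha]
    · simp only [hr, h, if_false]
      push Not at h
      rw [integral_const_mul]
      exact inv_mul_cancel₀ (by linarith)
  · change _ ≤ |1 - a s|
    by_cases h : a s ≤ 1
    · have hi : Integrable (fun x => C - w (s, x)) D := (integrable_const C).sub (hwi s)
      have : ∀ x, |r (s, x) - min (V (s, x)) C| = (1 - a s) / (C - a s) * (C - w (s, x)) := by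
        intro x
        have hc0 : 0 ≤ (1 - a s) / (C - a s) := div_nonneg (by linarith) (by linarith)
        simp only [hr, h, if_true]
        change |w (s, x) + _ - w (s, x)| = _
        rw [add_sub_cancel_left, abs_of_nonneg]
        exact mul_nonneg hc0 (sub_nonneg.2 (hwI _).2)
      simp only [this]
      rw [integral_const_mul, hup s, div_mul_cancel₀ _ (by linarith)]
      exact le_abs_self _
    · have h' := h
      push Not at h'
      have : ∀ x, |r (s, x) - min (V (s, x)) C| = (1 - (a s)⁻¹) * w (s, x) := by
        intro x
        have hc : (a s)⁻¹ ≤ 1 := inv_le_one_of_one_le₀ h'.le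
        simp only [hr, h, if_false]
        change |(a s)⁻¹ * w (s, x) - w (s, x)| = _
        rw [abs_sub_comm, abs_of_nonneg]
        · ring
        · have := mul_le_mul_of_nonneg_right hc (hwI (s, x)).1
          linarith
      simp only [this]
      rw [integral_const_mul]
      change (1 - (a s)⁻¹) * a s ≤ _
      rw [sub_mul, inv_mul_cancel₀ (by linarith), one_mul, abs_sub_comm]
      exact le_abs_self _

end Fill

section Hybrid

variable {X : Type*}

/-- The sequence whose first `k` terms are those of `S` and whose other terms are `x₀`. Functions of
`truncSeq x₀ k S` are the functions of the first `k` terms of `S`. -/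
def truncSeq (x₀ : X) (k : ℕ) (S : ℕ → X) : ℕ → X := fun i => if i < k then S i else x₀

lemma truncSeq_truncSeq (x₀ : X) {k l : ℕ} (h : k ≤ l) (S : ℕ → X) :
    truncSeq x₀ k (truncSeq x₀ l S) = truncSeq x₀ k S := by
  funext i
  unfold truncSeq
  by_cases hi : i < k
  · simp [hi, hi.trans_le h]
  · simp [hi]

variable [MeasurableSpace X]

lemma measurable_truncSeq (x₀ : X) (k : ℕ) : Measurable (truncSeq x₀ k) := by
  refine measurable_pi_lambda _ fun i => ?_
  unfold truncSeq
  split_ifs <;> fun_prop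

lemma integral_withDensity_ofReal {D : Measure X} {r : X → ℝ} (hr : Measurable r)
    (hr0 : ∀ x, 0 ≤ r x) (h : X → ℝ) :
    ∫ x, h x ∂(D.withDensity fun x => ENNReal.ofReal (r x)) = ∫ x, r x * h x ∂D := by
  rw [integral_withDensity_eq_integral_toReal_smul hr.ennreal_ofReal
    (Filter.Eventually.of_forall fun x => ENNReal.ofReal_lt_top)]
  simp [ENNReal.toReal_ofReal (hr0 _)]

lemma isProbabilityMeasure_withDensity_ofReal {D : Measure X} {r : X → ℝ}
    (hr0 : ∀ x, 0 ≤ r x) (hi : Integrable r D) (h1 : ∫ x, r x ∂D = 1) :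
    IsProbabilityMeasure (D.withDensity fun x => ENNReal.ofReal (r x)) := by
  constructor
  rw [withDensity_apply _ MeasurableSet.univ, Measure.restrict_univ,
    ← ofReal_integral_eq_lintegral_ofReal hi (Filter.Eventually.of_forall hr0), h1,
    ENNReal.ofReal_one]

/-- One of several independent draws may be drawn separately. -/
lemma integral_pi_eq_integral_update {n : ℕ} (Q : Measure X) [IsProbabilityMeasure Q]
    {h : (Fin n → X) → ℝ} (hm : Measurable h) {a b : ℝ} (hb : ∀ y, h y ∈ Set.Icc a b)
    (j : Fin n) :
    ∫ y, h y ∂(Measure.pi fun _ : Fin n => Q) =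
      ∫ x, ∫ y, h (fun i => if i = j then x else y i) ∂(Measure.pi fun _ : Fin n => Q) ∂Q := by
  rw [integral_mixCoord Q (fun i => i = j) hm (integrable_of_mem_Icc' hm hb)]
  have hG : StronglyMeasurable fun x => ∫ y, h (fun i => if i = j then x else y i)
      ∂(Measure.pi fun _ : Fin n => Q) := by
    have h1 : Measurable fun q : X × (Fin n → X) => h (fun i => if i = j then q.1 else q.2 i) := by
      refine hm.comp (measurable_pi_lambda _ fun i => ?_)
      split_ifs <;> fun_prop
    exact h1.stronglyMeasurable.integral_prod_right'
  rw [← integral_comp_eval (μ := fun _ : Fin n => Q) (i := j) hG.aestronglyMeasurable]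
  refine integral_congr_ae (Filter.Eventually.of_forall fun y => ?_)
  refine integral_congr_ae (Filter.Eventually.of_forall fun y' => ?_)
  refine congrArg h (funext fun i => ?_)
  unfold mixCoord
  by_cases hi : i = j
  · simp [hi]
  · simp [hi]

/-- Replacing the terms `S (k + j)` of a random sequence one after the other by fresh draws from
`κ (truncSeq x₀ k S)`, at the cost `τ` each: `τ` bounds the effect of replacing a term on test
functions of the terms before it. -/
lemma integral_le_integral_piKernel_add {μ : Measure (ℕ → X)} [IsProbabilityMeasure μ] (x₀ : X)
    {n k : ℕ} {f : (Fin n → X) → ℝ} (hf : Measurable f) (hf01 : ∀ y, f y ∈ Set.Icc 0 1)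
    (κ : Kernel (ℕ → X) X) [IsMarkovKernel κ] {τ : ℝ}
    (hstep : ∀ j < n, ∀ ψ : (ℕ → X) × X → ℝ, Measurable ψ → (∀ z, ψ z ∈ Set.Icc 0 1) →
      ∫ S, ψ (truncSeq x₀ (k + j) S, S (k + j)) ∂μ ≤
        ∫ S, ∫ x, ψ (truncSeq x₀ (k + j) S, x) ∂(κ (truncSeq x₀ k S)) ∂μ + τ) :
    ∫ S, f (fun i => S (k + i)) ∂μ ≤
      ∫ S, ∫ y, f y ∂(Measure.pi fun _ : Fin n => κ (truncSeq x₀ k S)) ∂μ + n * τ := by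
  -- the first `j` terms are those of the sequence, the others are fresh draws
  set H : ℕ → ℝ := fun j => ∫ S, ∫ y, f (fun i => if (i : ℕ) < j then S (k + i) else y i)
    ∂(Measure.pi fun _ : Fin n => κ (truncSeq x₀ k S)) ∂μ with hH
  have key : ∀ j ≤ n, H j ≤ H 0 + j * τ := by
    intro j
    induction j with
    | zero => intro _; simp
    | succ j ih =>
      intro hj
      set jj : Fin n := ⟨j, hj⟩ with hjj
      set ψ : (ℕ → X) × X → ℝ := fun z => ∫ y, f (fun i => if (i : ℕ) < j then z.1 (k + i) else
        if i = jj then z.2 else y i) ∂(piKernel (Fin n) κ (truncSeq x₀ k z.1)) with hψ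
      have hfm : Measurable fun q : ((ℕ → X) × X) × (Fin n → X) =>
          f (fun i => if (i : ℕ) < j then q.1.1 (k + i) else if i = jj then q.1.2 else q.2 i) := by
        refine hf.comp (measurable_pi_lambda _ fun i => ?_)
        split_ifs <;> fun_prop
      have hψm : Measurable ψ := by
        have : StronglyMeasurable fun z : (ℕ → X) × X => ∫ y, f (fun i => if (i : ℕ) < j then
            z.1 (k + i) else if i = jj then z.2 else y i)
              ∂(((piKernel (Fin n) κ).comap (fun z : (ℕ → X) × X => truncSeq x₀ k z.1)
                ((measurable_truncSeq x₀ k).comp measurable_fst)) z) :=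
          hfm.stronglyMeasurable.integral_kernel_prod_right'
        exact this.measurable
      have hψI : ∀ z, ψ z ∈ Set.Icc 0 1 := fun z =>
        integral_mem_Icc (hfm.comp measurable_prodMk_left) fun y => hf01 _
      have hψt : ∀ S x, ψ (truncSeq x₀ (k + j) S, x) = ψ (S, x) := by
        intro S x
        simp only [hψ, truncSeq_truncSeq x₀ (Nat.le_add_right k j)]
        refine integral_congr_ae (Filter.Eventually.of_forall fun y => congrArg f (funext fun i => ?_))
        by_cases hi : (i : ℕ) < j
        · simp [hi, truncSeq]
        · simp [hi]
      have h := hstep j hj ψ hψm hψI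
      simp only [hψt] at h
      have e1 : ∫ S, ψ (S, S (k + j)) ∂μ = H (j + 1) := by
        refine integral_congr_ae (Filter.Eventually.of_forall fun S => ?_)
        refine integral_congr_ae (Filter.Eventually.of_forall fun y => congrArg f (funext fun i => ?_))
        rcases lt_trichotomy (i : ℕ) j with hi | hi | hi
        · simp [hi, Nat.lt_succ_of_lt hi]
        · have : i = jj := Fin.ext hi
          simp [this, hjj]
        · have : i ≠ jj := fun h => by rw [h] at hi; exact lt_irrefl _ hi
          have h2 : ¬ (i : ℕ) < j + 1 := by omega
          simp [hi.le.not_gt, this, h2]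
      have e2 : ∫ S, ∫ x, ψ (S, x) ∂(κ (truncSeq x₀ k S)) ∂μ = H j := by
        refine integral_congr_ae (Filter.Eventually.of_forall fun S => ?_)
        simp only [hψ, piKernel_apply]
        have hm : Measurable fun y : Fin n → X =>
            f (fun i => if (i : ℕ) < j then S (k + i) else y i) := by
          refine hf.comp (measurable_pi_lambda _ fun i => ?_)
          split_ifs <;> fun_prop
        exact (integral_pi_eq_integral_update _ hm (fun y => hf01 _) jj).symm
      rw [e1, e2] at h
      have := ih (by omega)
      push_cast
      linarith
  have h := key n le_rfl
  have e : H n = ∫ S, f (fun i => S (k + i)) ∂μ := by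
    refine integral_congr_ae (Filter.Eventually.of_forall fun S => ?_)
    simp
  rw [e] at h
  simpa [hH] using h

end Hybrid

section Core

variable {X : Type*} [MeasurableSpace X]

/-- Let `(S, x)` have law `ρ`, where `x` is exchangeable with each of the first `N` terms of `S`
given the previous terms. If the law of `x` given the first `k` terms of `S` is essentially bounded
by `C • D`, then on average some `n` consecutive terms of `S` fool `f` at most as well as `n` i.i.d.
draws from a law with a density bounded by `C`. -/
theorem exists_integral_block_le (ρ : Measure ((ℕ → X) × X)) [IsProbabilityMeasure ρ]
    (D : Measure X) [IsProbabilityMeasure D] (x₀ : X) {C : ℝ} (hC : 1 < C) {N n B : ℕ} {δ : ℝ}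
    (hB : 0 < B) (hN : B * n ≤ N)
    (hexch : ∀ k < N, ρ.map (fun z => (truncSeq x₀ k z.1, z.1 k)) =
      ρ.map (fun z => (truncSeq x₀ k z.1, z.2)))
    (hac : ρ ≪ ρ.fst.prod D)
    (htail : ∀ k ≤ N, ∀ ψ : (ℕ → X) × X → ℝ, Measurable ψ → (∀ z, ψ z ∈ Set.Icc 0 1) →
      ∫ z, ψ (truncSeq x₀ k z.1, z.2) ∂ρ ≤
        C * ∫ z, ψ (truncSeq x₀ k z.1, z.2) ∂(ρ.fst.prod D) + δ)
    {f : (Fin n → X) → ℝ} (hf : Measurable f) (hf01 : ∀ y, f y ∈ Set.Icc 0 1) {v₀ : ℝ}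
    (hval : ∀ r : X → ℝ, Measurable r → (∀ x, r x ∈ Set.Icc 0 C) → ∫ x, r x ∂D = 1 →
      ∫ y, f y ∂(Measure.pi fun _ : Fin n => D.withDensity fun x => ENNReal.ofReal (r x)) ≤ v₀) :
    ∃ k, k + n ≤ N ∧
      ∫ z, f (fun i => z.1 (k + i)) ∂ρ ≤ v₀ + n * (4 * δ + √(2 * C / B)) := by
  set μ := ρ.fst with hμ
  set ν := μ.prod D with hν
  set p : ℕ → (ℕ → X) × X → (ℕ → X) × X := fun k z => (truncSeq x₀ k z.1, z.2) with hp
  have hpm : ∀ k, Measurable (p k) := fun k =>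
    ((measurable_truncSeq x₀ k).comp measurable_fst).prodMk measurable_snd
  have hpp : ∀ {k l}, k ≤ l → ∀ z, p k (p l z) = p k z := fun h z => by
    simp only [hp, truncSeq_truncSeq x₀ h]
  choose V hVm hV0 hVi hV using fun k => exists_density_comp hac (hpm k)
  set v : ℕ → (ℕ → X) × X → ℝ := fun k z => V k (p k z) with hv
  have hv0 : ∀ k z, 0 ≤ v k z := fun k z => hV0 k _
  -- `v l` integrates functions of the first `l` terms correctly
  have hint : ∀ {k l}, k ≤ l → ∀ ψ : (ℕ → X) × X → ℝ, Measurable ψ →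
      ∫ z, v l z * ψ (p k z) ∂ν = ∫ z, ψ (p k z) ∂ρ := by
    intro k l h ψ hψ
    have := hV l (fun z => ψ (p k z)) (hψ.comp (hpm k))
    simpa only [hpp h] using this
  have hv1 : ∀ k, ∫ z, v k z ∂ν = 1 := fun k => by
    have := hint (le_refl k) (fun _ => 1) measurable_const
    simpa using this
  have hmin : ∀ k, Integrable (fun z => min (v k z) C) ν := fun k => integrable_min_const (hVi k)
  have hmb : ∀ {k : ℕ} {g : (ℕ → X) × X → ℝ}, Measurable g → (∀ z, g z ∈ Set.Icc 0 C) →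
      Integrable (fun z => v k z * g z) ν := by
    intro k g hg hgI
    refine (hVi k).mul_bdd (c := C) hg.aestronglyMeasurable
      (Filter.Eventually.of_forall fun z => ?_)
    rw [Real.norm_eq_abs, abs_of_nonneg (hgI z).1]; exact (hgI z).2
  have horth : ∀ k l, k ≤ l → l ≤ N → ∫ z, min (v k z) C * (v l z - v k z) ∂ν = 0 := by
    intro k l hkl _
    have hm : Measurable fun z => min (V k z) C := (hVm k).min measurable_const
    have hI : ∀ z, min (v k z) C ∈ Set.Icc 0 C := fun z =>
      min_const_mem_Icc (by linarith) (hv0 k z)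
    have e1 := hint hkl _ hm
    have e2 := hint (le_refl k) _ hm
    have : ∀ z, min (v k z) C * (v l z - v k z) =
        v l z * min (v k z) C - v k z * min (v k z) C := fun z => by ring
    simp only [this]
    have hm' : Measurable fun z => min (v k z) C := hm.comp (hpm k)
    rw [integral_sub (hmb hm' hI) (hmb hm' hI)]
    exact sub_eq_zero.2 (e1.trans e2.symm)
  have htl : ∀ k ≤ N, ∫ z, (v k z - min (v k z) C) ∂ν ≤ δ := by
    intro k hk
    set ψ : (ℕ → X) × X → ℝ := Set.indicator {z | C < V k z} 1 with hψ
    have hψm : Measurable ψ := measurable_one.indicator (measurableSet_lt measurable_const (hVm k))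
    have hψI : ∀ z, ψ z ∈ Set.Icc 0 1 := fun z => by
      by_cases h : C < V k z <;> simp [hψ, h]
    have h := htail k hk ψ hψm hψI
    rw [← hint (le_refl k) ψ hψm] at h
    have hψi : Integrable (fun z => ψ (p k z)) ν :=
      integrable_of_mem_Icc' (hψm.comp (hpm k)) fun z => hψI _
    have : ∀ z, v k z - min (v k z) C = v k z * ψ (p k z) - C * ψ (p k z) := by
      intro z
      by_cases h : C < V k (p k z)
      · simp [hψ, h, hv, h.le]
      · simp [hψ, h, hv, not_lt.1 h]
    simp only [this]
    have hψp : Measurable fun z => ψ (p k z) := hψm.comp (hpm k)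
    rw [integral_sub (hmb hψp fun z => ⟨(hψI _).1, (hψI _).2.trans hC.le⟩)
      (hψi.const_mul C), integral_const_mul]
    exact sub_le_iff_le_add'.2 h
  obtain ⟨k, hkN, hk⟩ := exists_block_integral_abs_sub_le (by linarith) hVi hv0 hv1 hB hN horth htl
  refine ⟨k, hkN, ?_⟩
  obtain ⟨r, hrm, hrI, hr1, hrw⟩ := exists_density_le D hC (hVm k) (hV0 k)
  -- the bounded densities are close to the conditional densities given the first `k` terms
  have hra : Integrable (fun z => r (p k z)) ν :=
    integrable_of_mem_Icc' (hrm.comp (hpm k)) fun z => hrI _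
  have hclose : ∫ z, |v k z - r (p k z)| ∂ν ≤ 2 * δ := by
    have hle : ∫ z, |v k z - r (p k z)| ∂ν ≤
        ∫ z, ((v k z - min (v k z) C) + |r (p k z) - min (v k z) C|) ∂ν := by
      refine integral_mono ((hVi k).sub hra).abs
        (((hVi k).sub (hmin k)).add (hra.sub (hmin k)).abs) fun z => ?_
      have e1 : min (v k z) C ≤ v k z := min_le_left _ _
      simp only
      rcases abs_cases (v k z - r (p k z)) with h | h <;>
      rcases abs_cases (r (p k z) - min (v k z) C) with h' | h' <;> linarith
    have hd : Integrable (fun z => v k z - min (v k z) C) ν := (hVi k).sub (hmin k)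
    have hd' : Integrable (fun z => |r (p k z) - min (v k z) C|) ν := (hra.sub (hmin k)).abs
    rw [integral_add hd hd'] at hle
    set a : (ℕ → X) → ℝ := fun s => ∫ x, min (V k (s, x)) C ∂D with ha
    have ham : Measurable a :=
      ((hVm k).min measurable_const).stronglyMeasurable.integral_prod_right'.measurable
    set σ : (ℕ → X) → ℝ := fun s => if a s ≤ 1 then 1 else -1 with hσ
    have hσm : Measurable σ :=
      Measurable.ite (measurableSet_le ham measurable_const) measurable_const measurable_const
    have hσb : ∀ s, ‖σ s‖ ≤ 1 := fun s => by by_cases h : a s ≤ 1 <;> simp [hσ, h]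
    have hσa : ∀ s, |1 - a s| = σ s * (1 - a s) := fun s => by
      by_cases h : a s ≤ 1
      · simp [hσ, h]
      · push Not at h
        rw [abs_of_neg (by linarith)]; simp [hσ, h.not_ge]
    have hσpm : Measurable fun z : (ℕ → X) × X => σ (p k z).1 :=
      hσm.comp (measurable_fst.comp (hpm k))
    have hsv : Integrable (fun z => v k z * σ (p k z).1) ν :=
      (hVi k).mul_bdd (c := 1) hσpm.aestronglyMeasurable
        (Filter.Eventually.of_forall fun z => hσb _)
    have hsm : Integrable (fun z => min (v k z) C * σ (p k z).1) ν :=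
      (hmin k).mul_bdd (c := 1) hσpm.aestronglyMeasurable
        (Filter.Eventually.of_forall fun z => hσb _)
    have hai : ∀ s, a s ∈ Set.Icc 0 C := fun s => integral_mem_Icc
      (((hVm k).comp measurable_prodMk_left).min measurable_const)
        fun x => min_const_mem_Icc (by linarith) (hV0 k _)
    have hσi : Integrable (fun S => σ (truncSeq x₀ k S)) μ :=
      Integrable.of_bound (hσm.comp (measurable_truncSeq x₀ k)).aestronglyMeasurable 1
        (Filter.Eventually.of_forall fun S => hσb _)
    have hσai : Integrable (fun S => σ (truncSeq x₀ k S) * a (truncSeq x₀ k S)) μ :=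
      hσi.mul_bdd (c := C) (ham.comp (measurable_truncSeq x₀ k)).aestronglyMeasurable
        (Filter.Eventually.of_forall fun S => by
          rw [Real.norm_eq_abs, abs_of_nonneg (hai _).1]; exact (hai _).2)
    have h1 : ∫ z, |r (p k z) - min (v k z) C| ∂ν ≤ ∫ S, |1 - a (truncSeq x₀ k S)| ∂μ := by
      rw [hν, integral_prod _ hd']
      refine integral_mono hd'.integral_prod_left ?_ fun S => hrw (truncSeq x₀ k S)
      exact ((integrable_const _).sub (integrable_of_mem_Icc'
        (ham.comp (measurable_truncSeq x₀ k)) fun S => hai _)).abs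
    have h2 : ∫ S, |1 - a (truncSeq x₀ k S)| ∂μ =
        ∫ z, (v k z - min (v k z) C) * σ (p k z).1 ∂ν := by
      have e1 : ∫ z, v k z * σ (p k z).1 ∂ν = ∫ S, σ (truncSeq x₀ k S) ∂μ := by
        rw [hint (le_refl k) (fun z => σ z.1) (hσm.comp measurable_fst), hμ, Measure.fst,
          integral_map measurable_fst.aemeasurable]
        exact (hσm.comp (measurable_truncSeq x₀ k)).aestronglyMeasurable
      have e2 : ∫ z, min (v k z) C * σ (p k z).1 ∂ν =
          ∫ S, σ (truncSeq x₀ k S) * a (truncSeq x₀ k S) ∂μ := by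
        rw [hν, integral_prod _ hsm]
        refine integral_congr_ae (Filter.Eventually.of_forall fun S => ?_)
        simp only [hp, hv]
        rw [integral_mul_const, mul_comm]
      simp only [sub_mul, hσa, mul_sub, mul_one]
      rw [integral_sub hsv hsm, e1, e2, integral_sub hσi hσai]
    have h3 : ∫ z, (v k z - min (v k z) C) * σ (p k z).1 ∂ν ≤
        ∫ z, (v k z - min (v k z) C) ∂ν := by
      refine integral_mono (hd.mul_bdd (c := 1) hσpm.aestronglyMeasurable
        (Filter.Eventually.of_forall fun z => hσb _)) hd fun z => ?_
      have e1 : min (v k z) C ≤ v k z := min_le_left _ _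
      have e2 : σ (p k z).1 ≤ 1 := (le_abs_self _).trans (hσb _)
      simp only
      nlinarith
    have h4 := htl k (by omega)
    linarith
  -- the corresponding kernel
  set κ : Kernel (ℕ → X) X := (Kernel.const (ℕ → X) D).withDensity
    (fun S x => ENNReal.ofReal (r (S, x))) with hκ
  have hκa : ∀ S, κ S = D.withDensity fun x => ENNReal.ofReal (r (S, x)) := fun S => by
    rw [hκ, Kernel.withDensity_apply _ (by fun_prop)]; rfl
  have hrs : ∀ S, Measurable fun x => r (S, x) := fun S => hrm.comp measurable_prodMk_left
  have : IsMarkovKernel κ := ⟨fun S => by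
    rw [hκa]
    exact isProbabilityMeasure_withDensity_ofReal (fun x => (hrI _).1)
      (integrable_of_mem_Icc' (hrs S) fun x => hrI _) (hr1 S)⟩
  have hfin := integral_le_integral_piKernel_add (μ := μ) x₀ (n := n) (k := k) hf hf01 κ
    (τ := 4 * δ + √(2 * C / B)) ?_
  · have h1 : ∫ S, ∫ y, f y ∂(Measure.pi fun _ : Fin n => κ (truncSeq x₀ k S)) ∂μ ≤ v₀ := by
      have hle : ∀ S, ∫ y, f y ∂(Measure.pi fun _ : Fin n => κ (truncSeq x₀ k S)) ≤ v₀ := by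
        intro S
        simp only [hκa]
        exact hval _ (hrs _) (fun x => hrI _) (hr1 _)
      have hi : Integrable (fun S => ∫ y, f y ∂(Measure.pi fun _ : Fin n => κ (truncSeq x₀ k S)))
          μ := by
        have hm : StronglyMeasurable fun S => ∫ y, f y ∂(piKernel (Fin n) κ S) :=
          hf.stronglyMeasurable.integral_kernel
        exact integrable_of_mem_Icc' (hm.measurable.comp (measurable_truncSeq x₀ k))
          fun S => integral_mem_Icc hf hf01
      have := integral_mono hi (integrable_const v₀) hle
      simpa using this
    have h2 : ∫ z, f (fun i => z.1 (k + i)) ∂ρ = ∫ S, f (fun i => S (k + i)) ∂μ := by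
      rw [hμ, Measure.fst, integral_map measurable_fst.aemeasurable]
      exact (hf.comp (by fun_prop)).aestronglyMeasurable
    linarith
  · intro j hj ψ hψm hψI
    have hψp : Measurable fun z => ψ (p (k + j) z) := hψm.comp (hpm _)
    have e1 : ∫ S, ψ (truncSeq x₀ (k + j) S, S (k + j)) ∂μ = ∫ z, v (k + j) z * ψ (p (k + j) z) ∂ν := by
      have hm1 : Measurable fun z : (ℕ → X) × X => (truncSeq x₀ (k + j) z.1, z.1 (k + j)) :=
        ((measurable_truncSeq x₀ (k + j)).comp measurable_fst).prodMk (by fun_prop)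
      have hm2 : Measurable fun S : ℕ → X => (truncSeq x₀ (k + j) S, S (k + j)) :=
        (measurable_truncSeq x₀ (k + j)).prodMk (by fun_prop)
      have hψ2 : Measurable fun S : ℕ → X => ψ (truncSeq x₀ (k + j) S, S (k + j)) := hψm.comp hm2
      rw [hint (le_refl _) ψ hψm, hμ, Measure.fst, integral_map measurable_fst.aemeasurable
        hψ2.aestronglyMeasurable,
        ← integral_map hm1.aemeasurable hψm.aestronglyMeasurable, hexch (k + j) (by omega),
        integral_map (hpm _).aemeasurable hψm.aestronglyMeasurable]
    have hri : Integrable (fun z => r (p k z) * ψ (p (k + j) z)) ν :=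
      hra.mul_bdd (c := 1) hψp.aestronglyMeasurable (Filter.Eventually.of_forall fun z => by
        rw [Real.norm_eq_abs, abs_of_nonneg (hψI _).1]; exact (hψI _).2)
    have e2 : ∫ S, ∫ x, ψ (truncSeq x₀ (k + j) S, x) ∂(κ (truncSeq x₀ k S)) ∂μ =
        ∫ z, r (p k z) * ψ (p (k + j) z) ∂ν := by
      rw [hν, integral_prod _ hri]
      refine integral_congr_ae (Filter.Eventually.of_forall fun S => ?_)
      simp only [hκa]
      rw [integral_withDensity_ofReal (hrs _) (fun x => (hrI _).1)]
    rw [e1, e2, ← sub_le_iff_le_add']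
    have hvi : Integrable (fun z => v (k + j) z * ψ (p (k + j) z)) ν :=
      hmb hψp fun z => ⟨(hψI _).1, (hψI _).2.trans hC.le⟩
    rw [← integral_sub hvi hri]
    have h1 := hk j hj.le
    have hb1 : Integrable (fun z => |v (k + j) z - v k z|) ν := ((hVi _).sub (hVi _)).abs
    have hb2 : Integrable (fun z => |v k z - r (p k z)|) ν := ((hVi _).sub hra).abs
    have h2 : ∫ z, (v (k + j) z * ψ (p (k + j) z) - r (p k z) * ψ (p (k + j) z)) ∂ν ≤
        ∫ z, (|v (k + j) z - v k z| + |v k z - r (p k z)|) ∂ν := by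
      refine integral_mono (hvi.sub hri) (hb1.add hb2) fun z => ?_
      obtain ⟨h3, h4⟩ := hψI (p (k + j) z)
      have h5 := le_abs_self (v (k + j) z - v k z)
      have h6 := le_abs_self (v k z - r (p k z))
      have h7 := abs_nonneg (v (k + j) z - v k z)
      have h8 := abs_nonneg (v k z - r (p k z))
      simp only
      nlinarith
    rw [integral_add hb1 hb2] at h2
    linarith

end Core

/-! ### Points surviving a sample-dependent deletion -/

section KeptLaw

lemma embAvg_eq_sum_indicator {X : Type*} {M : ℕ} (C : (Fin M → X) → Finset (Fin M)) {k : ℕ}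
    (H : (Fin M → X) → (Fin k ↪ Fin M) → ℝ) (S : Fin M → X) :
    embAvg (C S) k (H S) =
      ∑ R : Finset (Fin M), (C ⁻¹' {R}).indicator (fun S => embAvg R k (H S)) S := by
  rw [Finset.sum_eq_single (C S)]
  · simp
  · intro R _ hR
    exact Set.indicator_of_notMem (fun h => hR (by simpa using h.symm)) _
  · simp

variable {X : Type*} [MeasurableSpace X] {M : ℕ}

lemma measurable_embAvg_const {Y : Type*} [MeasurableSpace Y] (R : Finset (Fin M)) {k : ℕ}
    {H : Y → (Fin k ↪ Fin M) → ℝ} (hH : ∀ e, Measurable fun S => H S e) :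
    Measurable fun S => embAvg R k (H S) := by
  unfold embAvg
  exact (Finset.measurable_sum _ fun e _ => hH _).const_mul _

lemma measurable_embAvg {C : (Fin M → X) → Finset (Fin M)}
    (hC : ∀ R, MeasurableSet (C ⁻¹' {R})) {k : ℕ} {H : (Fin M → X) → (Fin k ↪ Fin M) → ℝ}
    (hH : ∀ e, Measurable fun S => H S e) : Measurable fun S => embAvg (C S) k (H S) := by
  simp only [embAvg_eq_sum_indicator]
  exact Finset.measurable_sum _ fun R _ => (measurable_embAvg_const R hH).indicator (hC R)

/-- The law of `k` points drawn uniformly without replacement from those points of an i.i.d. sample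
`S` whose positions lie in the sample-dependent set `C S`. -/
noncomputable def keptLaw (D : Measure X) (C : (Fin M → X) → Finset (Fin M)) (k : ℕ) :
    Measure (Fin k → X) :=
  ∑ R : Finset (Fin M), ∑ e : Fin k ↪ R, ((Fintype.card (Fin k ↪ R) : NNReal)⁻¹) •
    ((Measure.pi fun _ : Fin M => D).restrict (C ⁻¹' {R})).map
      (fun S => S ∘ (e.trans (Function.Embedding.subtype (· ∈ R))))

variable {D : Measure X} [IsProbabilityMeasure D] {C : (Fin M → X) → Finset (Fin M)} {k : ℕ}

lemma measurable_comp_embedding (e : Fin k ↪ Fin M) : Measurable fun S : Fin M → X => S ∘ e :=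
  measurable_pi_lambda _ fun i => measurable_pi_apply (e i)

instance : IsFiniteMeasure (keptLaw D C k) := by
  unfold keptLaw
  infer_instance

lemma integral_keptLaw (hC : ∀ R, MeasurableSet (C ⁻¹' {R})) {h : (Fin k → X) → ℝ}
    (hh : Measurable h) {a b : ℝ} (hab : ∀ y, h y ∈ Set.Icc a b) :
    ∫ y, h y ∂(keptLaw D C k) =
      ∫ S, embAvg (C S) k (fun e => h (S ∘ e)) ∂(Measure.pi fun _ : Fin M => D) := by
  have hi : ∀ e : Fin k ↪ Fin M, Measurable fun S : Fin M → X => h (S ∘ e) := fun e =>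
    hh.comp (measurable_comp_embedding e)
  have hii : ∀ (e : Fin k ↪ Fin M) (Q : Measure (Fin M → X)) [IsFiniteMeasure Q],
      Integrable (fun S => h (S ∘ e)) Q := fun e Q _ => integrable_of_mem_Icc' (hi e) fun S => hab _
  have havg : ∀ R : Finset (Fin M), Integrable (fun S => embAvg R k (fun e => h (S ∘ e)))
      (Measure.pi fun _ : Fin M => D) := by
    intro R
    unfold embAvg
    exact (integrable_finsetSum _ fun e _ => hii _ _).const_mul _
  simp only [embAvg_eq_sum_indicator C (fun S e => h (S ∘ e))]
  rw [integral_finsetSum _ fun R _ => (havg R).indicator (hC R)]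
  unfold keptLaw
  rw [integral_finsetSum_measure fun R _ => integrable_of_mem_Icc' hh hab]
  refine Finset.sum_congr rfl fun R _ => ?_
  rw [integral_finsetSum_measure fun e _ => integrable_of_mem_Icc' hh hab,
    integral_indicator (hC R)]
  unfold embAvg
  rw [integral_const_mul, integral_finsetSum _ fun e _ => hii _ _, Finset.mul_sum]
  refine Finset.sum_congr rfl fun e _ => ?_
  rw [integral_smul_nnreal_measure,
    integral_map (measurable_comp_embedding _).aemeasurable hh.aestronglyMeasurable,
    NNReal.smul_def]
  simp

lemma keptLaw_real_apply (hC : ∀ R, MeasurableSet (C ⁻¹' {R})) {B : Set (Fin k → X)}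
    (hB : MeasurableSet B) :
    (keptLaw D C k).real B = ∫ S, embAvg (C S) k (fun e => B.indicator 1 (S ∘ e))
      ∂(Measure.pi fun _ : Fin M => D) := by
  rw [← integral_indicator_one hB]
  exact integral_keptLaw hC (measurable_one.indicator hB) (a := 0) (b := 1) fun y => by
    by_cases h : y ∈ B <;> simp [h]

lemma isProbabilityMeasure_keptLaw (hC : ∀ R, MeasurableSet (C ⁻¹' {R}))
    (hk : ∀ S, k ≤ (C S).card) : IsProbabilityMeasure (keptLaw D C k) := by
  have h := keptLaw_real_apply (D := D) (k := k) hC MeasurableSet.univ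
  simp only [Set.indicator_univ, Pi.one_apply, embAvg_const (hk _), integral_const,
    probReal_univ, smul_eq_mul, mul_one] at h
  exact ⟨by rwa [measureReal_def, ENNReal.toReal_eq_one_iff] at h⟩

/-- The draws are exchangeable, and fewer draws are obtained by forgetting some of them. -/
lemma keptLaw_map_comp (hC : ∀ R, MeasurableSet (C ⁻¹' {R})) {j : ℕ} (hk : ∀ S, k ≤ (C S).card)
    (ι : Fin j ↪ Fin k) : (keptLaw D C k).map (fun W => W ∘ ι) = keptLaw D C j := by
  have hι : Measurable fun W : Fin k → X => W ∘ ι := measurable_comp_embedding ι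
  ext B hB
  rw [← measureReal_eq_measureReal_iff, map_measureReal_apply hι hB,
    keptLaw_real_apply hC (hι hB), keptLaw_real_apply hC hB]
  refine integral_congr_ae (Filter.Eventually.of_forall fun S => ?_)
  exact embAvg_trans ι (hk S) (fun e => B.indicator (1 : (Fin j → X) → ℝ) (S ∘ e))

lemma keptLaw_absolutelyContinuous : keptLaw D C k ≪ Measure.pi fun _ : Fin k => D := by
  intro B hB
  obtain ⟨B', hBB', hB'm, hB'⟩ := exists_measurable_superset_of_null hB
  refine measure_mono_null hBB' ?_
  unfold keptLaw
  rw [Measure.finsetSum_apply]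
  refine Finset.sum_eq_zero fun R _ => ?_
  rw [Measure.finsetSum_apply]
  refine Finset.sum_eq_zero fun e _ => ?_
  rw [Measure.smul_apply]
  set e' := e.trans (Function.Embedding.subtype (· ∈ R)) with he'
  have h := pi_map_comp_injective D e'.injective
  have h0 : ((Measure.pi fun _ : Fin M => D).restrict (C ⁻¹' {R})).map (fun S => S ∘ e') B' = 0 := by
    refine Measure.AbsolutelyContinuous.map Measure.restrict_le_self.absolutelyContinuous
      (measurable_comp_embedding e') ?_
    rw [h, hB']
  rw [h0, smul_zero]

end KeptLaw

/-! ### Deletions cannot overfit -/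

section Tail

variable {X : Type*} [MeasurableSpace X] {M : ℕ} {D : Measure X} [IsProbabilityMeasure D]

lemma integral_exp_mul_le {Y : Type*} [MeasurableSpace Y] {Q : Measure Y} [IsProbabilityMeasure Q]
    {z : Y → ℝ} (hz : Measurable z) (hb : ∀ y, z y ∈ Set.Icc (-1) 1) (h0 : ∫ y, z y ∂Q = 0)
    {t : ℝ} (ht : t ∈ Set.Icc 0 1) : ∫ y, Real.exp (t * z y) ∂Q ≤ Real.exp (t ^ 2) := by
  have hzi : Integrable z Q := integrable_of_mem_Icc' hz hb
  have htz : ∀ y, |t * z y| ≤ t := fun y => by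
    rw [abs_mul, abs_of_nonneg ht.1]
    have : |z y| ≤ 1 := abs_le.2 (hb y)
    nlinarith [ht.1]
  have hi : Integrable (fun y => Real.exp (t * z y)) Q := by
    refine integrable_of_mem_Icc' (by fun_prop) (a := 0) (b := Real.exp t) fun y => ?_
    exact ⟨(Real.exp_pos _).le, Real.exp_le_exp.2 ((le_abs_self _).trans (htz y))⟩
  have h : ∫ y, Real.exp (t * z y) ∂Q ≤ ∫ y, (t * z y + (1 + t ^ 2)) ∂Q := by
    refine integral_mono hi ((hzi.const_mul t).add (integrable_const _)) fun y => ?_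
    have h1 := Real.abs_exp_sub_one_sub_id_le ((htz y).trans ht.2)
    have h2 := (abs_le.1 h1).2
    have h3 : (t * z y) ^ 2 ≤ t ^ 2 := sq_le_sq' (by linarith [(abs_le.1 (htz y)).1])
      (le_of_abs_le (htz y))
    simp only
    linarith
  rw [integral_add (hzi.const_mul t) (integrable_const _), integral_const_mul, h0] at h
  simp at h
  linarith [Real.add_one_le_exp (t ^ 2)]

/-- The excess of the sum of `φ` over the positions outside the range of `e` over its conditional
mean given the points at the positions in the range of `e`. -/
noncomputable def excess (D : Measure X) {k : ℕ} (φ : (Fin k → X) × X → ℝ) (S : Fin M → X)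
    (e : Fin k ↪ Fin M) : ℝ :=
  ∑ a ∈ Finset.univ.filter (fun a => ∀ i, e i ≠ a), (φ (S ∘ e, S a) - ∫ x, φ (S ∘ e, x) ∂D)

variable {k : ℕ} {φ : (Fin k → X) × X → ℝ}

lemma measurable_excess (hφ : Measurable φ) (e : Fin k ↪ Fin M) :
    Measurable fun S => excess D φ S e := by
  have h := measurable_comp_embedding (X := X) e
  have h2 : Measurable fun t : Fin k → X => ∫ x, φ (t, x) ∂D :=
    hφ.stronglyMeasurable.integral_prod_right'.measurable
  unfold excess
  exact Finset.measurable_sum _ fun a _ =>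
    (hφ.comp (h.prodMk (measurable_pi_apply a))).sub (h2.comp h)

lemma abs_excess_le (hφ : Measurable φ) (hφI : ∀ z, φ z ∈ Set.Icc 0 1) (S : Fin M → X)
    (e : Fin k ↪ Fin M) : |excess D φ S e| ≤ M := by
  unfold excess
  refine (Finset.abs_sum_le_sum_abs _ _).trans ?_
  refine (Finset.sum_le_card_nsmul _ _ 1 fun a _ => ?_).trans ?_
  · have h1 := hφI (S ∘ e, S a)
    have h2 : ∫ x, φ (S ∘ e, x) ∂D ∈ Set.Icc 0 1 :=
      integral_mem_Icc (hφ.comp measurable_prodMk_left) fun x => hφI _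
    exact abs_le.2 ⟨by linarith [h1.1, h2.2], by linarith [h1.2, h2.1]⟩
  · rw [nsmul_eq_mul, mul_one]
    exact_mod_cast (Finset.card_le_univ _).trans (by simp)

lemma integral_exp_excess_le (hφ : Measurable φ) (hφI : ∀ z, φ z ∈ Set.Icc 0 1)
    (e : Fin k ↪ Fin M) {t : ℝ} (ht : t ∈ Set.Icc 0 1) :
    ∫ S, Real.exp (t * excess D φ S e) ∂(Measure.pi fun _ : Fin M => D) ≤
      Real.exp (M * t ^ 2) := by
  classical
  have hm := measurable_excess (D := D) hφ e
  have hmem : ∀ S : Fin M → X,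
      Real.exp (t * excess D φ S e) ∈ Set.Icc 0 (Real.exp (t * M)) := fun S =>
    ⟨(Real.exp_pos _).le, Real.exp_le_exp.2 (mul_le_mul_of_nonneg_left
      ((le_abs_self _).trans (abs_excess_le hφ hφI S e)) ht.1)⟩
  have hme : Measurable fun S : Fin M → X => Real.exp (t * excess D φ S e) := by fun_prop
  -- the points at the positions of `e` are fixed; the other points are integrated out first
  rw [integral_mixCoord D (fun a => ∃ i, e i = a) hme (integrable_of_mem_Icc' hme hmem)]
  have hin : ∀ S : Fin M → X, ∫ S', Real.exp (t * excess D φ (mixCoord (fun a => ∃ i, e i = a) S S') e)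
      ∂(Measure.pi fun _ : Fin M => D) ≤ Real.exp (M * t ^ 2) := by
    intro S
    set c := ∫ x, φ (S ∘ e, x) ∂D with hc
    have hφm : Measurable fun x => φ (S ∘ e, x) := hφ.comp measurable_prodMk_left
    have hcI : c ∈ Set.Icc 0 1 := integral_mem_Icc hφm fun x => hφI _
    set g : Fin M → X → ℝ := fun a x =>
      if ∀ i, e i ≠ a then Real.exp (t * (φ (S ∘ e, x) - c)) else 1 with hg
    have hprod : ∀ S' : Fin M → X,
        Real.exp (t * excess D φ (mixCoord (fun a => ∃ i, e i = a) S S') e) = ∏ a, g a (S' a) := by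
      intro S'
      have h1 : mixCoord (fun a => ∃ i, e i = a) S S' ∘ e = S ∘ e := by
        funext i; simp [mixCoord]
      have h2 : ∀ a, (∀ i, e i ≠ a) → mixCoord (fun a => ∃ i, e i = a) S S' a = S' a := by
        intro a ha; simp [mixCoord, ha]
      unfold excess
      rw [h1, Finset.mul_sum, Real.exp_sum, Finset.prod_filter]
      refine Finset.prod_congr rfl fun a _ => ?_
      by_cases ha : ∀ i, e i ≠ a
      · simp only [hg, h2 a ha, ← hc]
      · simp only [hg, if_neg ha]
    simp only [hprod]
    rw [integral_fintype_prod_eq_prod]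
    calc ∏ a, ∫ x, g a x ∂D ≤ ∏ _a : Fin M, Real.exp (t ^ 2) := by
          refine Finset.prod_le_prod (fun a _ => integral_nonneg fun x => ?_) fun a _ => ?_
          · simp only [hg]; split_ifs <;> positivity
          · by_cases ha : ∀ i, e i ≠ a
            · simp only [hg, if_pos ha]
              refine integral_exp_mul_le (by fun_prop) (fun x => ?_) ?_ ht
              · have := hφI (S ∘ e, x)
                exact ⟨by linarith [this.1, hcI.2], by linarith [this.2, hcI.1]⟩
              · rw [integral_sub (integrable_of_mem_Icc' hφm fun x => hφI _) (integrable_const _)]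
                simp [hc]
            · simp only [hg, if_neg ha]
              simp [Real.one_le_exp (sq_nonneg t)]
      _ = Real.exp (M * t ^ 2) := by simp [← Real.exp_nat_mul]
  have hle := integral_mono_of_nonneg (μ := Measure.pi fun _ : Fin M => D)
    (Filter.Eventually.of_forall fun S => integral_nonneg fun S' => (Real.exp_pos _).le)
    (integrable_const (Real.exp (M * t ^ 2))) (Filter.Eventually.of_forall hin)
  simpa using hle

lemma descFactorial_le_exp_mul {m : ℕ} {L : ℝ} (hkm : k < m)
    (hL : (M : ℝ) ≤ L * ((m : ℝ) - k)) :
    (M.descFactorial k : ℝ) ≤ Real.exp (k * L) * m.descFactorial k := by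
  have hpos : (0 : ℝ) < (m : ℝ) - k := by rw [sub_pos]; exact_mod_cast hkm
  have h1 : (M.descFactorial k : ℝ) ≤ (M : ℝ) ^ k := by exact_mod_cast Nat.descFactorial_le_pow M k
  have h2 : ((m : ℝ) - k) ^ k ≤ m.descFactorial k := by
    have h3 : ((m + 1 - k : ℕ) : ℝ) ^ k ≤ m.descFactorial k := by
      exact_mod_cast Nat.pow_sub_le_descFactorial m k
    refine (pow_le_pow_left₀ hpos.le ?_ k).trans h3
    rw [Nat.cast_sub (by omega)]
    push_cast
    linarith
  calc (M.descFactorial k : ℝ) ≤ (M : ℝ) ^ k := h1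
    _ ≤ (L * ((m : ℝ) - k)) ^ k := by gcongr
    _ = L ^ k * ((m : ℝ) - k) ^ k := mul_pow _ _ _
    _ ≤ Real.exp (k * L) * m.descFactorial k := by
        have hL0 : 0 ≤ L := by
          by_contra h
          have : (0 : ℝ) ≤ M := by positivity
          nlinarith
        rw [Real.exp_nat_mul]
        gcongr
        linarith [Real.add_one_le_exp L]

/-- Among the surviving points the average excess is small: the positions of the `k` surviving
draws are at most `exp (k * L)` times as likely as under uniform sampling from all positions,
whereas the excess has subgaussian exponential moments. -/
lemma integral_embAvg_excess_le {C : (Fin M → X) → Finset (Fin M)}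
    (hC : ∀ R, MeasurableSet (C ⁻¹' {R})) (hφ : Measurable φ) (hφI : ∀ z, φ z ∈ Set.Icc 0 1)
    {m : ℕ} (hm : ∀ S, m ≤ (C S).card) (hkm : k < m) {L : ℝ}
    (hL : (M : ℝ) ≤ L * ((m : ℝ) - k)) {t : ℝ} (ht0 : 0 < t) (ht1 : t ≤ 1) :
    ∫ S, embAvg (C S) k (excess D φ S) ∂(Measure.pi fun _ : Fin M => D) ≤
      (k * L + M * t ^ 2) / t := by
  set P := Measure.pi fun _ : Fin M => D with hP
  set b : ℝ := k * L + M * t ^ 2 with hb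
  have hmE : ∀ e : Fin k ↪ Fin M, Measurable fun S : Fin M → X => excess D φ S e :=
    measurable_excess hφ
  have hexpI : ∀ (S : Fin M → X) e, Real.exp (t * excess D φ S e) ∈ Set.Icc 0 (Real.exp (t * M)) :=
    fun S e => ⟨(Real.exp_pos _).le, Real.exp_le_exp.2 (mul_le_mul_of_nonneg_left
      ((le_abs_self _).trans (abs_excess_le hφ hφI S e)) ht0.le)⟩
  have hexpm : ∀ e : Fin k ↪ Fin M, Measurable fun S : Fin M → X => Real.exp (t * excess D φ S e) :=
    fun e => ((hmE e).const_mul t).exp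
  have hkC : ∀ S, k ≤ (C S).card := fun S => hkm.le.trans (hm S)
  have hi1 : Integrable (fun S => embAvg (C S) k (excess D φ S)) P :=
    integrable_of_mem_Icc' (measurable_embAvg hC hmE) fun S =>
      embAvg_mem_Icc (hkC S) fun e => abs_le.1 (abs_excess_le hφ hφI S e)
  have hi2 : Integrable (fun S => embAvg (C S) k (fun e => Real.exp (t * excess D φ S e))) P :=
    integrable_of_mem_Icc' (measurable_embAvg hC hexpm) fun S =>
      embAvg_mem_Icc (hkC S) fun e => hexpI S e
  have hexp : ∫ S, embAvg (C S) k (fun e => Real.exp (t * excess D φ S e)) ∂P ≤ Real.exp b := by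
    have hd : (0 : ℝ) < m.descFactorial k := by exact_mod_cast Nat.descFactorial_pos.2 hkm.le
    have hie : ∀ e : Fin k ↪ Fin M, Integrable (fun S => Real.exp (t * excess D φ S e)) P := fun e =>
      integrable_of_mem_Icc' (hexpm e) fun S => hexpI S e
    calc ∫ S, embAvg (C S) k (fun e => Real.exp (t * excess D φ S e)) ∂P
        ≤ ∫ S, (m.descFactorial k : ℝ)⁻¹ * ∑ e : Fin k ↪ Fin M, Real.exp (t * excess D φ S e) ∂P :=
          integral_mono hi2 ((integrable_finsetSum _ fun e _ => hie e).const_mul _) fun S =>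
            embAvg_le_sum (fun e => (Real.exp_pos _).le) hkm.le (hm S)
      _ = (m.descFactorial k : ℝ)⁻¹ * ∑ e : Fin k ↪ Fin M, ∫ S, Real.exp (t * excess D φ S e) ∂P := by
          rw [integral_const_mul, integral_finsetSum _ fun e _ => hie e]
      _ ≤ (m.descFactorial k : ℝ)⁻¹ * ∑ _e : Fin k ↪ Fin M, Real.exp (M * t ^ 2) := by
          gcongr with e
          exact integral_exp_excess_le hφ hφI e ⟨ht0.le, ht1⟩
      _ = (m.descFactorial k : ℝ)⁻¹ * M.descFactorial k * Real.exp (M * t ^ 2) := by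
          rw [Finset.sum_const, Finset.card_univ, Fintype.card_embedding_eq, nsmul_eq_mul]
          simp [mul_assoc]
      _ ≤ Real.exp (k * L) * Real.exp (M * t ^ 2) := by
          gcongr
          rw [inv_mul_le_iff₀ hd, mul_comm]
          exact descFactorial_le_exp_mul hkm hL
      _ = Real.exp b := by rw [hb, Real.exp_add]
  -- `u ≤ exp (u - b) + b - 1` with `u` the scaled excess
  have hlin : t * ∫ S, embAvg (C S) k (excess D φ S) ∂P ≤
      ∫ S, (Real.exp (-b) * embAvg (C S) k (fun e => Real.exp (t * excess D φ S e)) +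
        (b - 1)) ∂P := by
    rw [← integral_const_mul]
    refine integral_mono (hi1.const_mul t) ((hi2.const_mul _).add (integrable_const _)) fun S => ?_
    simp only
    rw [← embAvg_const_mul, ← embAvg_const_mul, ← embAvg_const (hkC S) (b - 1), ← embAvg_add]
    refine embAvg_mono fun e _ => ?_
    have := Real.add_one_le_exp (-b + t * excess D φ S e)
    rw [Real.exp_add] at this
    linarith
  rw [integral_add (hi2.const_mul _) (integrable_const _), integral_const_mul] at hlin
  have h1 : Real.exp (-b) * ∫ S, embAvg (C S) k (fun e => Real.exp (t * excess D φ S e)) ∂P ≤ 1 := by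
    calc _ ≤ Real.exp (-b) * Real.exp b := by gcongr
      _ = 1 := by rw [← Real.exp_add]; simp
  simp only [integral_const, probReal_univ, smul_eq_mul, one_mul] at hlin
  rw [le_div_iff₀ ht0]
  linarith

end Tail

section Tail

variable {X : Type*} [MeasurableSpace X] {M : ℕ} {D : Measure X} [IsProbabilityMeasure D]
  {k : ℕ} {φ : (Fin k → X) × X → ℝ}

/-- Given the first `k` surviving draws, the law of the next one is essentially bounded by `c • D`:
at most a fraction `1 - c⁻¹` of the points is deleted, and the points not drawn so far are not far
from being distributed according to `D`. -/
lemma integral_embAvg_succ_le {C : (Fin M → X) → Finset (Fin M)}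
    (hC : ∀ R, MeasurableSet (C ⁻¹' {R})) (hφ : Measurable φ) (hφI : ∀ z, φ z ∈ Set.Icc 0 1)
    {m N : ℕ} (hm : ∀ S, m ≤ (C S).card) (hkN : k ≤ N) (hNm : N < m) (hM : 1 ≤ M) {c : ℝ}
    (hc : 1 ≤ c) (hMm : (M : ℝ) ≤ c * m) (hMN : (M : ℝ) ≤ 2 * c * (m - N)) :
    ∫ S, embAvg (C S) (k + 1) (fun e => φ (S ∘ ((Fin.succEmb k).trans e), S (e 0)))
      ∂(Measure.pi fun _ : Fin M => D) ≤
      c * ∫ S, embAvg (C S) k (fun e => ∫ x, φ (S ∘ e, x) ∂D) ∂(Measure.pi fun _ : Fin M => D) +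
        2 * c * (3 * c * N + 1) / √M := by
  set P := Measure.pi fun _ : Fin M => D with hP
  have hkm : k < m := by omega
  have hkmR : (k : ℝ) < m := by exact_mod_cast hkm
  have hkNR : (k : ℝ) ≤ N := by exact_mod_cast hkN
  have hMR : (1 : ℝ) ≤ M := by exact_mod_cast hM
  have hpos : (0 : ℝ) < m - k := by linarith
  have hmM : m ≤ M := by
    have S₀ : Nonempty (Fin M → X) := P.nonempty_of_neZero
    exact (hm S₀.some).trans ((Finset.card_le_univ _).trans (by simp))
  have hkC : ∀ S, k ≤ (C S).card := fun S => hkm.le.trans (hm S)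
  have hbm : Measurable fun t : Fin k → X => ∫ x, φ (t, x) ∂D :=
    hφ.stronglyMeasurable.integral_prod_right'.measurable
  have hbI : ∀ t : Fin k → X, ∫ x, φ (t, x) ∂D ∈ Set.Icc 0 1 := fun t =>
    integral_mem_Icc (hφ.comp measurable_prodMk_left) fun x => hφI _
  have hem := fun e : Fin k ↪ Fin M => measurable_comp_embedding (X := X) e
  set I := ∫ S, embAvg (C S) k (fun e => ∫ x, φ (S ∘ e, x) ∂D) ∂P with hI
  have hIm : Measurable fun S => embAvg (C S) k (fun e => ∫ x, φ (S ∘ e, x) ∂D) :=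
    measurable_embAvg hC (H := fun S e => ∫ x, φ (S ∘ e, x) ∂D) fun e => hbm.comp (hem e)
  have hIS : ∀ S, embAvg (C S) k (fun e => ∫ x, φ (S ∘ e, x) ∂D) ∈ Set.Icc 0 1 := fun S =>
    embAvg_mem_Icc (hkC S) fun e => hbI _
  have hI01 : I ∈ Set.Icc 0 1 := integral_mem_Icc hIm hIS
  have hIi : Integrable (fun S => embAvg (C S) k (fun e => ∫ x, φ (S ∘ e, x) ∂D)) P :=
    integrable_of_mem_Icc' hIm hIS
  have hEi : Integrable (fun S => embAvg (C S) k (excess D φ S)) P :=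
    integrable_of_mem_Icc' (measurable_embAvg hC fun e => measurable_excess hφ e) fun S =>
      embAvg_mem_Icc (hkC S) fun e => abs_le.1 (abs_excess_le hφ hφI S e)
  have hpt : ∀ S, embAvg (C S) (k + 1) (fun e => φ (S ∘ ((Fin.succEmb k).trans e), S (e 0))) ≤
      ((m : ℝ) - k)⁻¹ * (embAvg (C S) k (excess D φ S) +
        ((M : ℝ) - k) * embAvg (C S) k (fun e => ∫ x, φ (S ∘ e, x) ∂D)) := by
    intro S
    refine (embAvg_succ_le (H := fun e a => φ (S ∘ e, S a)) (fun e a => (hφI _).1) hkm (hm S)).trans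
      (mul_le_mul_of_nonneg_left (le_of_eq ?_) (by positivity))
    rw [← embAvg_const_mul, ← embAvg_add]
    congr 1
    funext e
    have hcard : ((Finset.univ.filter fun a => ∀ i, e i ≠ a).card : ℝ) = M - k := by
      have h1 : (Finset.univ.filter fun a => ∀ i, e i ≠ a) = (Finset.univ.map e)ᶜ := by
        ext a; simp
      rw [h1, Finset.card_compl, Finset.card_map, Fintype.card_fin, Finset.card_univ,
        Fintype.card_fin, Nat.cast_sub (by omega)]
    unfold excess
    rw [Finset.sum_sub_distrib, Finset.sum_const, nsmul_eq_mul, hcard]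
    ring
  have hlm : Measurable fun S => embAvg (C S) (k + 1)
      (fun e => φ (S ∘ ((Fin.succEmb k).trans e), S (e 0))) :=
    measurable_embAvg hC (H := fun S e => φ (S ∘ ((Fin.succEmb k).trans e), S (e 0))) fun e =>
      hφ.comp ((hem _).prodMk (measurable_pi_apply _))
  have h1 := integral_mono (integrable_of_mem_Icc' (μ := P) hlm fun S =>
    embAvg_mem_Icc (lt_of_lt_of_le hkm (hm S)) fun e => hφI _)
    ((hEi.add (hIi.const_mul _)).const_mul _) hpt
  simp only [Pi.add_apply] at h1
  rw [integral_const_mul, integral_add hEi (hIi.const_mul _), integral_const_mul, ← hI] at h1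
  have hsq : (0 : ℝ) < √M := Real.sqrt_pos.2 (by linarith)
  have hsq1 : 1 ≤ √(M : ℝ) := Real.one_le_sqrt.2 hMR
  have hss : √(M : ℝ) * √M = M := Real.mul_self_sqrt (by linarith)
  -- the choice `t = 1 / √M` balances the two terms of the bound on the excess
  have h2 := integral_embAvg_excess_le (D := D) hC hφ hφI hm hkm (L := 2 * c) (by nlinarith)
    (t := (√M)⁻¹) (inv_pos.2 hsq) (inv_le_one_of_one_le₀ hsq1)
  have h3 : ((k : ℝ) * (2 * c) + M * (√M)⁻¹ ^ 2) / (√M)⁻¹ = (k * (2 * c) + 1) * √M := by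
    rw [div_inv_eq_mul, inv_pow, Real.sq_sqrt (by linarith), mul_inv_cancel₀ (by linarith)]
  rw [h3] at h2
  have hk0 : (0 : ℝ) ≤ k := by positivity
  have h4 : ((m : ℝ) - k)⁻¹ * (((M : ℝ) - k) * I) ≤ c * I + ((m : ℝ) - k)⁻¹ * (c * k) := by
    have : ((M : ℝ) - k) * I ≤ (m - k) * (c * I) + c * k := by
      have h5 : (M : ℝ) - k ≤ c * (m - k) + c * k := by linarith
      have h6 := mul_le_mul_of_nonneg_right h5 hI01.1
      have h7 : c * k * I ≤ c * k * 1 := mul_le_mul_of_nonneg_left hI01.2 (by positivity)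
      linarith
    calc _ ≤ ((m : ℝ) - k)⁻¹ * ((m - k) * (c * I) + c * k) := by gcongr
      _ = _ := by rw [mul_add, inv_mul_cancel_left₀ hpos.ne']
  have h5 : ((m : ℝ) - k)⁻¹ * ((k * (2 * c) + 1) * √M + c * k) ≤
      2 * c * (3 * c * N + 1) / √M := by
    rw [inv_mul_le_iff₀ hpos, mul_div_assoc', le_div_iff₀ hsq]
    have h6 : (k * (2 * c) + 1) * √M + c * k ≤ (3 * c * N + 1) * √M := by
      have e1 : c * k ≤ c * k * √M := le_mul_of_one_le_right (by positivity) hsq1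
      have e2 : c * k * √M ≤ c * N * √M := by gcongr
      linarith
    calc ((k * (2 * c) + 1) * √M + c * k) * √M ≤ ((3 * c * N + 1) * √M) * √M := by gcongr
      _ = (3 * c * N + 1) * M := by rw [mul_assoc, hss]
      _ ≤ (3 * c * N + 1) * (2 * c * (m - k)) := by
          gcongr
          refine hMN.trans ?_
          gcongr
      _ = _ := by ring
  have h6 : ((m : ℝ) - k)⁻¹ * ∫ S, embAvg (C S) k (excess D φ S) ∂P ≤
      ((m : ℝ) - k)⁻¹ * ((k * (2 * c) + 1) * √M) := by gcongr
  rw [mul_add] at h1 h5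
  linarith

end Tail

/-! ### The adaptive adversary is not stronger than the oblivious one -/

section Sequence

variable {X : Type*}

/-- A finite sequence, extended by the constant `x₀`. -/
def extendSeq (x₀ : X) (k : ℕ) (W : Fin k → X) : ℕ → X :=
  fun i => if h : i < k then W ⟨i, h⟩ else x₀

/-- The extension of the tail of `W`, together with the head of `W`. -/
def tailHead (x₀ : X) (k : ℕ) (W : Fin (k + 1) → X) : (ℕ → X) × X :=
  (extendSeq x₀ k (W ∘ Fin.succ), W 0)

lemma truncSeq_tailHead (x₀ : X) {k N : ℕ} (h : k ≤ N) (W : Fin (N + 1) → X) :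
    (truncSeq x₀ k (tailHead x₀ N W).1, (tailHead x₀ N W).2) =
      tailHead x₀ k (W ∘ Fin.castLE (Nat.succ_le_succ h)) := by
  refine Prod.ext (funext fun i => ?_) rfl
  by_cases hi : i < k
  · simp [truncSeq, tailHead, extendSeq, hi, hi.trans_le h]
  · simp [truncSeq, tailHead, extendSeq, hi]

/-- The injection of `Fin (k + 1)` into `Fin (N + 1)` that sends `0` to `k + 1` and fixes all other
elements. -/
def headToSucc {k N : ℕ} (h : k < N) : Fin (k + 1) ↪ Fin (N + 1) where
  toFun i := ⟨if (i : ℕ) = 0 then k + 1 else i, by split_ifs <;> omega⟩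
  inj' i j hij := by
    simp only [Fin.mk.injEq] at hij
    refine Fin.ext ?_
    split_ifs at hij <;> omega

lemma headToSucc_zero {k N : ℕ} (h : k < N) : headToSucc h 0 = ⟨k + 1, by omega⟩ := rfl

lemma headToSucc_succ {k N : ℕ} (h : k < N) (i : Fin k) :
    headToSucc h i.succ = ⟨i + 1, by omega⟩ := by
  refine Fin.ext ?_
  simp [headToSucc]

/-- The injection of `Fin n` into `Fin (N + 1)` whose image is the block `k + 1, …, k + n`. -/
def blockEmb {k n N : ℕ} (h : k + n ≤ N) : Fin n ↪ Fin (N + 1) where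
  toFun i := ⟨k + i + 1, by omega⟩
  inj' i j hij := by
    simp only [Fin.mk.injEq] at hij
    exact Fin.ext (by omega)

lemma tailHead_fst_block (x₀ : X) {k n N : ℕ} (h : k + n ≤ N) (W : Fin (N + 1) → X) :
    (fun i : Fin n => (tailHead x₀ N W).1 (k + i)) = W ∘ blockEmb h := by
  funext i
  have hi : k + i < N := by omega
  simp only [tailHead, extendSeq, hi, dif_pos]
  rfl

lemma truncSeq_tailHead_succ (x₀ : X) {k N : ℕ} (h : k < N) (W : Fin (N + 1) → X) :
    (truncSeq x₀ k (tailHead x₀ N W).1, (tailHead x₀ N W).1 k) =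
      tailHead x₀ k (W ∘ headToSucc h) := by
  refine Prod.ext (funext fun i => ?_) ?_
  · by_cases hi : i < k
    · have := headToSucc_succ h ⟨i, hi⟩
      simp only [truncSeq, tailHead, extendSeq, hi, hi.trans h, if_true, dif_pos,
        Function.comp_apply, this]
      rfl
    · simp [truncSeq, tailHead, extendSeq, hi]
  · simp only [tailHead, extendSeq, h, dif_pos, Function.comp_apply, headToSucc_zero]
    rfl

variable [MeasurableSpace X]

lemma measurable_extendSeq (x₀ : X) (k : ℕ) : Measurable (extendSeq x₀ k) := by
  refine measurable_pi_lambda _ fun i => ?_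
  unfold extendSeq
  split_ifs <;> fun_prop

lemma measurable_tailHead (x₀ : X) (k : ℕ) : Measurable (tailHead x₀ k) :=
  ((measurable_extendSeq x₀ k).comp (measurable_pi_lambda _ fun _ => measurable_pi_apply _)).prodMk
    (measurable_pi_apply _)

lemma absolutelyContinuous_fst_prod {Y : Type*} [MeasurableSpace Y] {ρ : Measure (Y × X)}
    {α : Measure Y} {D : Measure X} [IsFiniteMeasure ρ] [IsFiniteMeasure D] [IsFiniteMeasure α]
    (h : ρ ≪ α.prod D) : ρ ≪ ρ.fst.prod D := by
  refine Measure.AbsolutelyContinuous.mk fun B hB h0 => ?_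
  have hsec : Measurable fun s => D (Prod.mk s ⁻¹' B) := measurable_measure_prodMk_left hB
  set Z : Set Y := {s | D (Prod.mk s ⁻¹' B) ≠ 0} with hZ
  have hZm : MeasurableSet Z := (measurableSet_eq_fun hsec measurable_const).compl
  have hZ0 : ρ (Prod.fst ⁻¹' Z) = 0 := by
    rw [Measure.measure_prod_null hB] at h0
    rw [← Measure.fst_apply hZm]
    exact h0
  have hrest : ρ (B \ Prod.fst ⁻¹' Z) = 0 := by
    refine h ?_
    rw [Measure.measure_prod_null (hB.diff (measurable_fst hZm))]
    refine Filter.Eventually.of_forall fun s => ?_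
    by_cases hs : s ∈ Z
    · have : Prod.mk s ⁻¹' (B \ Prod.fst ⁻¹' Z) = ∅ := by ext x; simp [hs]
      simp [this]
    · have hs' : D (Prod.mk s ⁻¹' B) = 0 := not_not.1 hs
      exact measure_mono_null (fun x hx => hx.1) hs'
  refine measure_mono_null (t := Prod.fst ⁻¹' Z ∪ (B \ Prod.fst ⁻¹' Z)) ?_
    (measure_union_null hZ0 hrest)
  rw [Set.union_sdiff_self]
  exact Set.subset_union_right

end Sequence

/-- A rule that keeps at least `m ≥ M / c` of the points of an i.i.d. sample, which may depend on
the whole sample, fools `f` hardly more than i.i.d. draws from a law with a density bounded by `c`. -/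
theorem integral_embAvg_kept_le {X : Type*} [MeasurableSpace X] {M : ℕ} {D : Measure X}
    [IsProbabilityMeasure D] {C : (Fin M → X) → Finset (Fin M)}
    (hC : ∀ R, MeasurableSet (C ⁻¹' {R})) {m n B : ℕ} (hm : ∀ S, m ≤ (C S).card) (hB : 0 < B)
    (hNm : B * n < m) (hM : 1 ≤ M) {c : ℝ} (hc : 1 < c) (hMm : (M : ℝ) ≤ c * m)
    (hMN : (M : ℝ) ≤ 2 * c * (m - B * n))
    {f : (Fin n → X) → ℝ} (hf : Measurable f) (hf01 : ∀ y, f y ∈ Set.Icc 0 1) {v₀ : ℝ}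
    (hval : ∀ r : X → ℝ, Measurable r → (∀ x, r x ∈ Set.Icc 0 c) → ∫ x, r x ∂D = 1 →
      ∫ y, f y ∂(Measure.pi fun _ : Fin n => D.withDensity fun x => ENNReal.ofReal (r x)) ≤ v₀) :
    ∫ S, embAvg (C S) n (fun e => f (S ∘ e)) ∂(Measure.pi fun _ : Fin M => D) ≤
      v₀ + n * (4 * (2 * c * (3 * c * (B * n) + 1) / √M) + √(2 * c / B)) := by
  obtain ⟨x₀⟩ : Nonempty X := D.nonempty_of_neZero
  set N := B * n with hN
  have hNC : ∀ S, N + 1 ≤ (C S).card := fun S => hNm.trans_le (hm S)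
  have hprob := isProbabilityMeasure_keptLaw (D := D) hC hNC
  have hth := measurable_tailHead x₀ N
  set ρ := (keptLaw D C (N + 1)).map (tailHead x₀ N) with hρ
  have : IsProbabilityMeasure ρ := Measure.isProbabilityMeasure_map hth.aemeasurable
  have htr : ∀ k, Measurable fun z : (ℕ → X) × X => (truncSeq x₀ k z.1, z.2) := fun k =>
    ((measurable_truncSeq x₀ k).comp measurable_fst).prodMk measurable_snd
  have hmap1 : ∀ k ≤ N, ρ.map (fun z => (truncSeq x₀ k z.1, z.2)) =
      (keptLaw D C (k + 1)).map (tailHead x₀ k) := by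
    intro k hk
    have hι := keptLaw_map_comp (D := D) hC hNC (Fin.castLEEmb (Nat.succ_le_succ hk))
    rw [hρ, Measure.map_map (htr k) hth, ← hι,
      Measure.map_map (measurable_tailHead x₀ k) (measurable_comp_embedding _)]
    exact congrArg (fun g => (keptLaw D C (N + 1)).map g) (funext (truncSeq_tailHead x₀ hk))
  have hmap2 : ∀ k < N, ρ.map (fun z => (truncSeq x₀ k z.1, z.1 k)) =
      (keptLaw D C (k + 1)).map (tailHead x₀ k) := by
    intro k hk
    have hι := keptLaw_map_comp (D := D) hC hNC (headToSucc hk)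
    have htr' : Measurable fun z : (ℕ → X) × X => (truncSeq x₀ k z.1, z.1 k) :=
      ((measurable_truncSeq x₀ k).comp measurable_fst).prodMk (by fun_prop)
    rw [hρ, Measure.map_map htr' hth, ← hι,
      Measure.map_map (measurable_tailHead x₀ k) (measurable_comp_embedding _)]
    exact congrArg (fun g => (keptLaw D C (N + 1)).map g) (funext (truncSeq_tailHead_succ x₀ hk))
  have hac : ρ ≪ ρ.fst.prod D := by
    refine absolutelyContinuous_fst_prod
      (α := (Measure.pi fun _ : Fin N => D).map (extendSeq x₀ N)) ?_
    have h1 : ρ ≪ (Measure.pi fun _ : Fin (N + 1) => D).map (tailHead x₀ N) :=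
      keptLaw_absolutelyContinuous.map hth
    have h2 : (Measure.pi fun _ : Fin (N + 1) => D).map (tailHead x₀ N) =
        ((Measure.pi fun _ : Fin N => D).map (extendSeq x₀ N)).prod D := by
      have h3 := (measurePreserving_piFinSuccAbove (fun _ : Fin (N + 1) => D) 0).map_eq
      have h4 : tailHead x₀ N = (Prod.map (extendSeq x₀ N) id ∘ Prod.swap) ∘
          (MeasurableEquiv.piFinSuccAbove (fun _ : Fin (N + 1) => X) 0) := by
        funext W
        rfl
      rw [h4, ← Measure.map_map (((measurable_extendSeq x₀ N).prodMap measurable_id).comp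
        measurable_swap) (MeasurableEquiv.measurable _), h3,
        ← Measure.map_map ((measurable_extendSeq x₀ N).prodMap measurable_id) measurable_swap,
        Measure.prod_swap, ← Measure.map_prod_map _ _ (measurable_extendSeq x₀ N) measurable_id,
        Measure.map_id]
    rwa [h2] at h1
  have htail : ∀ k ≤ N, ∀ ψ : (ℕ → X) × X → ℝ, Measurable ψ → (∀ z, ψ z ∈ Set.Icc 0 1) →
      ∫ z, ψ (truncSeq x₀ k z.1, z.2) ∂ρ ≤
        c * ∫ z, ψ (truncSeq x₀ k z.1, z.2) ∂(ρ.fst.prod D) +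
          2 * c * (3 * c * N + 1) / √M := by
    intro k hk ψ hψ hψI
    set φ : (Fin k → X) × X → ℝ := fun z => ψ (extendSeq x₀ k z.1, z.2) with hφ
    have hφm : Measurable φ := hψ.comp
      (((measurable_extendSeq x₀ k).comp measurable_fst).prodMk measurable_snd)
    have hφI : ∀ z, φ z ∈ Set.Icc 0 1 := fun z => hψI _
    have h := integral_embAvg_succ_le (D := D) hC hφm hφI hm hk hNm hM hc.le hMm
      (by rw [hN]; push_cast; exact hMN)
    have hψt : Measurable fun z : (ℕ → X) × X => ψ (truncSeq x₀ k z.1, z.2) := hψ.comp (htr k)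
    have e1 : ∫ z, ψ (truncSeq x₀ k z.1, z.2) ∂ρ = ∫ S, embAvg (C S) (k + 1)
        (fun e => φ (S ∘ ((Fin.succEmb k).trans e), S (e 0))) ∂(Measure.pi fun _ : Fin M => D) := by
      have hψh : Measurable fun W : Fin (k + 1) → X => ψ (tailHead x₀ k W) :=
        hψ.comp (measurable_tailHead x₀ k)
      rw [← integral_map (htr k).aemeasurable hψ.aestronglyMeasurable, hmap1 k hk,
        integral_map (measurable_tailHead x₀ k).aemeasurable hψ.aestronglyMeasurable,
        integral_keptLaw hC hψh fun W => hψI _]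
      rfl
    have e2 : ∫ z, ψ (truncSeq x₀ k z.1, z.2) ∂(ρ.fst.prod D) =
        ∫ S, embAvg (C S) k (fun e => ∫ x, φ (S ∘ e, x) ∂D) ∂(Measure.pi fun _ : Fin M => D) := by
      have hbm : Measurable fun t : Fin k → X => ∫ x, φ (t, x) ∂D :=
        hφm.stronglyMeasurable.integral_prod_right'.measurable
      have hbm' : Measurable fun S : ℕ → X => ∫ x, ψ (truncSeq x₀ k S, x) ∂D :=
        hψt.stronglyMeasurable.integral_prod_right'.measurable
      have hbf : Measurable fun z : (ℕ → X) × X => ∫ x, ψ (truncSeq x₀ k z.1, x) ∂D :=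
        hbm'.comp measurable_fst
      have hι := keptLaw_map_comp (D := D) hC hNC
        ((Fin.succEmb k).trans (Fin.castLEEmb (Nat.succ_le_succ hk)))
      rw [← integral_keptLaw hC hbm (a := 0) (b := 1) fun t => integral_mem_Icc
          (hφm.comp measurable_prodMk_left) fun x => hφI _,
        integral_prod _ (integrable_of_mem_Icc' hψt fun z => hψI _), Measure.fst,
        integral_map measurable_fst.aemeasurable hbm'.aestronglyMeasurable, hρ,
        integral_map hth.aemeasurable hbf.aestronglyMeasurable, ← hι,
        integral_map (measurable_comp_embedding _).aemeasurable hbm.aestronglyMeasurable]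
      refine integral_congr_ae (Filter.Eventually.of_forall fun W => ?_)
      have h5 := congrArg Prod.fst (truncSeq_tailHead x₀ hk W)
      simp only at h5
      simp only [h5]
      rfl
    rw [e1, e2]
    exact h
  obtain ⟨k, hk, hle⟩ := exists_integral_block_le ρ D x₀ hc (N := N) (n := n)
    (δ := 2 * c * (3 * c * N + 1) / √M) hB le_rfl
    (fun k hk => (hmap2 k hk).trans (hmap1 k hk.le).symm) hac htail hf hf01 hval
  have hι := keptLaw_map_comp (D := D) hC hNC (blockEmb hk)
  have hfm : Measurable fun z : (ℕ → X) × X => f (fun i => z.1 (k + i)) :=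
    hf.comp (by fun_prop)
  rw [← integral_keptLaw hC hf hf01, ← hι,
    integral_map (measurable_comp_embedding _).aemeasurable hf.aestronglyMeasurable]
  rw [hρ, integral_map hth.aemeasurable hfm.aestronglyMeasurable] at hle
  simp only [tailHead_fst_block x₀ hk] at hle
  have hNR : (N : ℝ) = B * n := by rw [hN]; push_cast; rfl
  rwa [hNR] at hle

lemma isProbabilityMeasure_of_mem_subDist {X : Type u} [MeasurableSpace X] {η : ℝ} (hη : η < 1)
    {D D' : Measure X} (h : D' ∈ subDist η D) : IsProbabilityMeasure D' := by
  obtain ⟨Ω, _, P, x, E, hP, hx, hE, hD, hPE, rfl⟩ := h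
  have hE0 : P E ≠ 0 := fun h0 => by
    rw [h0, nonpos_iff_eq_zero, ENNReal.ofReal_eq_zero] at hPE
    linarith
  have := cond_isProbabilityMeasure hE0
  exact Measure.isProbabilityMeasure_map hx.aemeasurable

/-- A law with a density bounded by `(1 - η)⁻¹` is a subtractive contamination: a draw `x` is kept
with probability `(1 - η) * r x`, decided by an independent coin. -/
lemma withDensity_mem_subDist {X : Type u} [MeasurableSpace X] {η : ℝ} (hη : η < 1)
    (D : Measure X) [IsProbabilityMeasure D] {r : X → ℝ} (hr : Measurable r)
    (hrI : ∀ x, r x ∈ Set.Icc 0 (1 / (1 - η))) (hr1 : ∫ x, r x ∂D = 1) :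
    (D.withDensity fun x => ENNReal.ofReal (r x)) ∈ subDist η D := by
  have h1 : 0 < 1 - η := by linarith
  set s : X → ℝ := fun x => (1 - η) * r x with hs
  have hsm : Measurable s := hr.const_mul _
  have hs0 : ∀ x, 0 ≤ s x := fun x => mul_nonneg h1.le (hrI x).1
  have hs1 : ∀ x, s x ≤ 1 := fun x => by
    have := mul_le_mul_of_nonneg_left (hrI x).2 h1.le
    rwa [mul_one_div_cancel h1.ne'] at this
  set j : Bool → X → X × ULift.{u} Bool := fun b x => (x, ULift.up b) with hj
  have hjm : ∀ b, Measurable (j b) := fun b => measurable_id.prodMk measurable_const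
  set P : Measure (X × ULift.{u} Bool) :=
    (D.withDensity fun x => ENNReal.ofReal (s x)).map (j true) +
      (D.withDensity fun x => ENNReal.ofReal (1 - s x)).map (j false) with hP
  set E : Set (X × ULift.{u} Bool) := Prod.snd ⁻¹' {ULift.up true} with hE
  have hEm : MeasurableSet E := measurable_snd (measurableSet_singleton _)
  have hfst : ∀ b, Prod.fst ∘ j b = id := fun b => rfl
  have hPD : P.map Prod.fst = D := by
    rw [hP, Measure.map_add _ _ measurable_fst, Measure.map_map measurable_fst (hjm _),
      Measure.map_map measurable_fst (hjm _), hfst, hfst, Measure.map_id, Measure.map_id,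
      ← withDensity_add_left (by fun_prop)]
    have : ((fun x => ENNReal.ofReal (s x)) + fun x => ENNReal.ofReal (1 - s x)) = 1 := by
      funext x
      rw [Pi.add_apply, ← ENNReal.ofReal_add (hs0 x) (by linarith [hs1 x])]
      simp
    rw [this, withDensity_one]
  have hPE : P.restrict E = (D.withDensity fun x => ENNReal.ofReal (s x)).map (j true) := by
    have ht : j true ⁻¹' E = Set.univ := by ext x; simp [hj, hE]
    have hf : j false ⁻¹' E = ∅ := by ext x; simp [hj, hE]
    rw [hP, Measure.restrict_add, Measure.restrict_map (hjm _) hEm,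
      Measure.restrict_map (hjm _) hEm, ht, hf]
    simp
  have hsD : (D.withDensity fun x => ENNReal.ofReal (s x)) =
      ENNReal.ofReal (1 - η) • D.withDensity fun x => ENNReal.ofReal (r x) := by
    rw [← withDensity_smul _ (by fun_prop)]
    congr 1
    funext x
    simp [hs, ENNReal.ofReal_mul h1.le]
  have hprob := isProbabilityMeasure_withDensity_ofReal (D := D) (fun x => (hrI x).1)
    (integrable_of_mem_Icc' hr hrI) hr1
  have hPE' : P E = ENNReal.ofReal (1 - η) := by
    rw [← Measure.restrict_apply_univ, hPE, Measure.map_apply (hjm _) MeasurableSet.univ,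
      Set.preimage_univ, hsD, Measure.smul_apply, measure_univ, smul_eq_mul, mul_one]
  refine ⟨X × ULift.{u} Bool, inferInstance, P, Prod.fst, E, ?_, measurable_fst, hEm, hPD,
    hPE'.ge, ?_⟩
  · constructor
    have : P.map Prod.fst Set.univ = 1 := by rw [hPD]; exact measure_univ
    rwa [Measure.map_apply measurable_fst MeasurableSet.univ, Set.preimage_univ] at this
  · unfold ProbabilityTheory.cond
    rw [hPE, hPE', Measure.map_smul, Measure.map_map measurable_fst (hjm _), hfst, Measure.map_id,
      hsD, smul_smul, ENNReal.inv_mul_cancel (by simpa using hη) ENNReal.ofReal_ne_top, one_smul]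

/-- A maximizer among finitely many measurable functions can be chosen measurably. -/
lemma exists_measurable_argmax {Y ι : Type*} [MeasurableSpace Y] [Fintype ι] {s : Finset ι}
    (hs : s.Nonempty) {F : Y → ι → ℝ} (hF : ∀ i, Measurable fun y => F y i) :
    ∃ g : Y → ι, (∀ i, MeasurableSet (g ⁻¹' {i})) ∧ (∀ y, g y ∈ s) ∧
      ∀ y, ∀ i ∈ s, F y i ≤ F y (g y) := by
  classical
  induction hs using Finset.Nonempty.cons_induction with
  | singleton a =>
    exact ⟨fun _ => a, fun i => MeasurableSet.const (a = i), by simp, by simp⟩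
  | cons a s ha hs ih =>
    obtain ⟨g, hg, hgs, hmax⟩ := ih
    have hA : MeasurableSet {y | F y (g y) ≤ F y a} := by
      have : {y | F y (g y) ≤ F y a} = ⋃ i, g ⁻¹' {i} ∩ {y | F y i ≤ F y a} := by
        ext y; simp
      rw [this]
      exact MeasurableSet.iUnion fun i => (hg i).inter (measurableSet_le (hF i) (hF a))
    refine ⟨fun y => if F y (g y) ≤ F y a then a else g y, fun i => ?_, fun y => ?_, fun y i hi => ?_⟩
    · have : (fun y => if F y (g y) ≤ F y a then a else g y) ⁻¹' {i} =
          ({y | F y (g y) ≤ F y a} ∩ {_y | a = i}) ∪ ({y | F y (g y) ≤ F y a}ᶜ ∩ g ⁻¹' {i}) := by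
        ext y
        by_cases h : F y (g y) ≤ F y a <;> simp [h]
      rw [this]
      exact (hA.inter (MeasurableSet.const _)).union (hA.compl.inter (hg i))
    · by_cases h : F y (g y) ≤ F y a <;> simp [h, hgs y]
    · rcases Finset.mem_cons.1 hi with rfl | hi
      · by_cases h : F y (g y) ≤ F y i
        · simp [h]
        · simp [h, (not_le.1 h).le]
      · by_cases h : F y (g y) ≤ F y a
        · simpa [h] using (hmax y i hi).trans h
        · simpa [h] using hmax y i hi

/-- The value of the adaptive adversary is attained by a measurable choice of the points to keep. -/
lemma exists_kept_eq_adaptive {X : Type u} [MeasurableSpace X] {M n : ℕ} (η : ℝ)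
    {f : (Fin n → X) → ℝ} (hf : Measurable f) :
    ∃ C : (Fin M → X) → Finset (Fin M), (∀ R, MeasurableSet (C ⁻¹' {R})) ∧
      (∀ S, M - ⌊η * M⌋₊ ≤ (C S).card) ∧ ∀ S,
        IsGreatest ((fun S' : Sample X => ∫ T, f T ∂(subsamplingFilter n S')) '' subSample η S)
          (embAvg (C S) n fun e => f (S ∘ e)) := by
  classical
  set s : Finset (Finset (Fin M)) := Finset.univ.filter fun R => R.card ≤ ⌊η * M⌋₊ with hs
  obtain ⟨g, hg, hgs, hmax⟩ := exists_measurable_argmax (s := s) ⟨∅, by simp [hs]⟩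
    (F := fun (S : Fin M → X) R => embAvg Rᶜ n fun e => f (S ∘ e))
    (fun R => measurable_embAvg_const Rᶜ fun e => hf.comp (measurable_comp_embedding e))
  refine ⟨fun S => (g S)ᶜ, fun R => ?_, fun S => ?_, fun S => ⟨?_, ?_⟩⟩
  · have : (fun S => (g S)ᶜ) ⁻¹' {R} = g ⁻¹' {Rᶜ} := by
      ext S
      exact ⟨fun h => (compl_compl (g S)).symm.trans (congrArg _ h), fun h =>
        (congrArg _ h).trans (compl_compl R)⟩
    rw [this]; exact hg _
  · have := hgs S
    simp only [hs, Finset.mem_filter, Finset.mem_univ, true_and] at this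
    rw [Finset.card_compl, Fintype.card_fin]
    omega
  · refine ⟨removePoints S (g S), ⟨g S, by simpa [hs] using hgs S, rfl⟩, ?_⟩
    exact integral_subsamplingFilter_removePoints hf S _
  · rintro _ ⟨_, ⟨R, hR, rfl⟩, rfl⟩
    simp only [integral_subsamplingFilter_removePoints hf]
    exact hmax S R (by simpa [hs] using hR)

lemma bddAbove_oblivious {X : Type u} [MeasurableSpace X] {n : ℕ} {η : ℝ} (hη : η < 1)
    {D : Measure X} {f : (Fin n → X) → ℝ} (hf : Measurable f) (hf01 : ∀ y, f y ∈ Set.Icc 0 1) :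
    BddAbove ((fun D' : Measure X => ∫ S, f S ∂(Measure.pi fun _ : Fin n => D')) ''
      subDist η D) := by
  refine ⟨1, ?_⟩
  rintro _ ⟨D', hD', rfl⟩
  have := isProbabilityMeasure_of_mem_subDist hη hD'
  exact (integral_mem_Icc hf hf01).2

theorem adaptiveSubMax_le {X : Type u} [MeasurableSpace X] {M n B : ℕ} {η : ℝ} (hη0 : 0 < η)
    (hη : η < 1) (D : Measure X) [IsProbabilityMeasure D] {f : (Fin n → X) → ℝ}
    (hf : Measurable f) (hf01 : ∀ y, f y ∈ Set.Icc 0 1) {c : ℝ} (hc : c = 1 / (1 - η)) (hB : 0 < B)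
    {m : ℕ} (hmdef : m = M - ⌊η * M⌋₊) (hNm : B * n < m) (hMm : (M : ℝ) ≤ c * m)
    (hMN : (M : ℝ) ≤ 2 * c * (m - B * n)) :
    adaptiveSubMax η M f D ≤ obliviousSubMax η f D +
      n * (4 * (2 * c * (3 * c * (B * n) + 1) / √M) + √(2 * c / B)) := by
  obtain ⟨C, hC, hCm, hCg⟩ := exists_kept_eq_adaptive (M := M) η hf
  have h1 : adaptiveSubMax η M f D =
      ∫ S, embAvg (C S) n (fun e => f (S ∘ e)) ∂(Measure.pi fun _ : Fin M => D) :=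
    integral_congr_ae (Filter.Eventually.of_forall fun S => (hCg S).csSup_eq)
  rw [h1]
  have hc1 : 1 < c := by
    rw [hc, lt_div_iff₀ (by linarith)]; linarith
  refine integral_embAvg_kept_le hC (fun S => hmdef ▸ hCm S) hB hNm (by omega) hc1 hMm hMN hf hf01
    fun r hr hrI hr1 => ?_
  exact le_csSup (bddAbove_oblivious hη hf hf01)
    ⟨_, withDensity_mem_subDist hη D hr (hc ▸ hrI) hr1, rfl⟩

/-! ### The oblivious adversary is not stronger than the adaptive one -/

section Easy

variable {Ω : Type*}

/-- The positions of the sample points that lie in `E`. -/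
noncomputable def goodSet {M : ℕ} (E : Set Ω) (ω : Fin M → Ω) : Finset (Fin M) :=
  open Classical in Finset.univ.filter fun i => ω i ∈ E

lemma mem_goodSet {M : ℕ} {E : Set Ω} {ω : Fin M → Ω} {i : Fin M} :
    i ∈ goodSet E ω ↔ ω i ∈ E := by
  simp [goodSet]

variable [MeasurableSpace Ω]

lemma measurableSet_goodSet_preimage {M : ℕ} {E : Set Ω} (hE : MeasurableSet E)
    (g : Finset (Fin M)) : MeasurableSet (goodSet E ⁻¹' {g}) := by
  have : goodSet E ⁻¹' {g} = ⋂ i, {ω : Fin M → Ω | ω i ∈ E ↔ i ∈ g} := by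
    ext ω
    simp only [Set.mem_preimage, Set.mem_singleton_iff, Set.mem_iInter, Set.mem_ofPred_eq,
      Finset.ext_iff, mem_goodSet]
  rw [this]
  refine MeasurableSet.iInter fun i => ?_
  exact (measurable_pi_apply i hE).iff (MeasurableSet.const _)

/-- Conditioning each of several independent draws on `E` is conditioning the product law on the
event that all draws lie in `E`. -/
lemma pi_cond (P : Measure Ω) [IsProbabilityMeasure P] {E : Set Ω} (hE : MeasurableSet E)
    (hE0 : P E ≠ 0) (n : ℕ) :
    (Measure.pi fun _ : Fin n => P[|E]) =
      (Measure.pi fun _ : Fin n => P)[|Set.univ.pi fun _ => E] := by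
  have := cond_isProbabilityMeasure hE0
  refine (Measure.pi_eq fun t ht => ?_)
  rw [cond_apply (MeasurableSet.univ_pi fun _ => hE), ← Set.pi_inter_distrib, Measure.pi_pi,
    Measure.pi_pi]
  simp only [cond_apply hE, Finset.prod_mul_distrib, Finset.prod_const, ENNReal.inv_pow]

/-- If `h` has mean zero under the law conditioned on `E`, then so has the value of `h` at sample
points in `E`, whatever is known about which of the sample points lie in `E`. -/
lemma setIntegral_goodSet_eq_zero {M n : ℕ} (P : Measure Ω) [IsProbabilityMeasure P] {E : Set Ω}
    (hE : MeasurableSet E) {h : (Fin n → Ω) → ℝ} (hh : Measurable h) {b : ℝ}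
    (hb : ∀ y, h y ∈ Set.Icc (-b) b)
    (h0 : ∫ y in Set.univ.pi fun _ => E, h y ∂(Measure.pi fun _ : Fin n => P) = 0)
    (g : Finset (Fin M)) (e : Fin n ↪ Fin M) (he : ∀ i, e i ∈ g) :
    ∫ ω in goodSet E ⁻¹' {g}, h (ω ∘ e) ∂(Measure.pi fun _ : Fin M => P) = 0 := by
  classical
  have hem := measurable_comp_embedding (X := Ω) e
  have hg := measurableSet_goodSet_preimage (M := M) hE g
  have hEn : MeasurableSet (Set.univ.pi fun _ : Fin n => E) := MeasurableSet.univ_pi fun _ => hE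
  have hhe : Measurable fun ω : Fin M → Ω => h (ω ∘ e) := hh.comp hem
  have hT : Measurable ((goodSet E ⁻¹' {g}).indicator fun ω : Fin M → Ω => h (ω ∘ e)) :=
    hhe.indicator hg
  have hTi : Integrable ((goodSet E ⁻¹' {g}).indicator fun ω : Fin M → Ω => h (ω ∘ e))
      (Measure.pi fun _ : Fin M => P) :=
    (integrable_of_mem_Icc' hhe fun ω => hb _).indicator hg
  rw [← integral_indicator hg, integral_mixCoord P (fun a => ∃ i, e i = a) hT hTi]
  -- the pattern of the points in `E` splits into the conditions at and off the positions of `e`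
  have hsplit : ∀ ω ω' : Fin M → Ω, (goodSet E ⁻¹' {g}).indicator (fun ω : Fin M → Ω => h (ω ∘ e))
        (mixCoord (fun a => ∃ i, e i = a) ω ω') =
      (Set.univ.pi fun _ => E).indicator h (ω ∘ e) *
        {ω' : Fin M → Ω | ∀ a, (∀ i, e i ≠ a) → (ω' a ∈ E ↔ a ∈ g)}.indicator 1 ω' := by
    intro ω ω'
    have h1 : mixCoord (fun a => ∃ i, e i = a) ω ω' ∘ e = ω ∘ e := by
      funext i; simp [mixCoord]
    have h2 : ∀ i, mixCoord (fun a => ∃ i, e i = a) ω ω' (e i) = ω (e i) := fun i =>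
      congrFun h1 i
    have h3 : ∀ a, (∀ i, e i ≠ a) → mixCoord (fun a => ∃ i, e i = a) ω ω' a = ω' a := by
      intro a ha; simp [mixCoord, ha]
    have hiff : mixCoord (fun a => ∃ i, e i = a) ω ω' ∈ goodSet E ⁻¹' {g} ↔
        ω ∘ e ∈ (Set.univ.pi fun _ => E) ∧
          ω' ∈ {ω' : Fin M → Ω | ∀ a, (∀ i, e i ≠ a) → (ω' a ∈ E ↔ a ∈ g)} := by
      simp only [Set.mem_preimage, Set.mem_singleton_iff, Finset.ext_iff, mem_goodSet,
        Set.mem_univ_pi, Set.mem_ofPred_eq]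
      constructor
      · intro H
        refine ⟨fun i => ?_, fun a ha => ?_⟩
        · have := (H (e i)).2 (he i)
          rwa [h2] at this
        · rw [← h3 a ha]; exact H a
      · rintro ⟨H1, H2⟩ a
        by_cases ha : ∀ i, e i ≠ a
        · rw [h3 a ha]; exact H2 a ha
        · push Not at ha
          obtain ⟨i, rfl⟩ := ha
          rw [h2]
          exact ⟨fun _ => he i, fun _ => H1 i⟩
    simp only [Set.indicator_apply, hiff, h1, Pi.one_apply]
    by_cases ha : ω ∘ e ∈ (Set.univ.pi fun _ => E) <;>
    by_cases hb : ω' ∈ {ω' : Fin M → Ω | ∀ a, (∀ i, e i ≠ a) → (ω' a ∈ E ↔ a ∈ g)} <;>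
      simp [ha, hb]
  simp only [hsplit, integral_const_mul, integral_mul_const]
  have h4 : ∫ ω : Fin M → Ω, (Set.univ.pi fun _ => E).indicator h (ω ∘ e)
      ∂(Measure.pi fun _ : Fin M => P) = 0 := by
    have h5 := integral_map (μ := Measure.pi fun _ : Fin M => P) hem.aemeasurable
      (hh.indicator hEn).aestronglyMeasurable
    rw [pi_map_comp_injective P e.injective, integral_indicator hEn, h0] at h5
    exact h5.symm
  rw [h4, zero_mul]

/-- Averaging over injections that may use points outside `g` costs at most `n` times the
proportion of such points. -/
lemma one_sub_le_embAvg_ite {α : Type*} [DecidableEq α] {K g : Finset α} {n : ℕ} (hn : n ≤ K.card)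
    (hgK : g ⊆ K) :
    1 - n * (((K.card : ℝ) - g.card) / K.card) ≤
      embAvg K n (fun e => if ∀ i, e i ∈ g then 1 else 0) := by
  have h1 : ∀ i : Fin n, embAvg K n (fun e => if e i ∈ g then (0 : ℝ) else 1) =
      ((K.card : ℝ) - g.card) / K.card := by
    intro i
    have h2 := embAvg_trans (C := K) (k := n) (⟨fun _ : Fin 1 => i, fun a b _ =>
      Subsingleton.elim a b⟩ : Fin 1 ↪ Fin n) hn (fun e => if e 0 ∈ g then (0 : ℝ) else 1)
    refine h2.trans ?_
    unfold embAvg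
    rw [card_fin_embedding, Nat.descFactorial_one, div_eq_inv_mul]
    congr 1
    have h3 : ∑ e : Fin 1 ↪ K, (if (e 0 : α) ∈ g then (0 : ℝ) else 1) =
        ∑ a : K, (if (a : α) ∈ g then (0 : ℝ) else 1) :=
      (Equiv.uniqueEmbeddingEquivResult (α := Fin 1) (β := K)).sum_comp
        (fun a : K => if (a : α) ∈ g then (0 : ℝ) else 1)
    refine h3.trans ?_
    rw [Finset.sum_coe_sort K (fun a => if a ∈ g then (0 : ℝ) else 1), Finset.sum_ite]
    simp only [Finset.sum_const_zero, Finset.sum_const, zero_add, nsmul_eq_mul, mul_one]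
    rw [Finset.filter_notMem_eq_sdiff, Finset.card_sdiff_of_subset hgK,
      Nat.cast_sub (Finset.card_le_card hgK)]
  have h2 : ∀ s : Finset (Fin n), embAvg K n (fun e => ∑ i ∈ s, if e i ∈ g then (0 : ℝ) else 1) =
      ∑ i ∈ s, embAvg K n (fun e => if e i ∈ g then (0 : ℝ) else 1) := by
    intro s
    induction s using Finset.induction_on with
    | empty => simp [embAvg]
    | insert a s ha ih => simp only [Finset.sum_insert ha, embAvg_add, ih]
  have h3 : embAvg K n (fun e => ∑ i, if e i ∈ g then (0 : ℝ) else 1) =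
      n * (((K.card : ℝ) - g.card) / K.card) := by
    rw [h2]; simp [h1]
  rw [sub_le_iff_le_add, ← h3, ← embAvg_add]
  refine (embAvg_const hn 1).symm.le.trans (embAvg_mono fun e _ => ?_)
  by_cases h : ∀ i, e i ∈ g
  · simp [h]
  · push Not at h
    obtain ⟨i, hi⟩ := h
    have h4 : (1 : ℝ) ≤ ∑ i, if e i ∈ g then (0 : ℝ) else 1 := by
      refine le_trans ?_ (Finset.single_le_sum (f := fun i => if e i ∈ g then (0 : ℝ) else 1)
        (fun i _ => by split_ifs <;> norm_num) (Finset.mem_univ i))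
      simp [hi]
    have h5 : (0 : ℝ) ≤ if ∀ i, e i ∈ g then 1 else 0 := by split_ifs <;> norm_num
    linarith

/-- The expected shortfall of the number of sample points in an event below a target that exceeds
its mean by at most `1`. -/
lemma integral_shortfall_le {M : ℕ} (hM : 1 ≤ M) (P : Measure Ω) [IsProbabilityMeasure P]
    {E : Set Ω} (hE : MeasurableSet E) {m : ℝ} (hm : m ≤ P.real E * M + 1) :
    ∫ ω, max (m - (goodSet E ω).card) 0 ∂(Measure.pi fun _ : Fin M => P) ≤ 4 * √M := by
  classical
  have hMR : (1 : ℝ) ≤ M := by exact_mod_cast hM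
  have hsq : (0 : ℝ) < √M := Real.sqrt_pos.2 (by linarith)
  have hsq1 : 1 ≤ √(M : ℝ) := Real.one_le_sqrt.2 hMR
  set φ : (Fin 0 → Ω) × Ω → ℝ := fun z => Eᶜ.indicator 1 z.2 with hφ
  have hφm : Measurable φ := (measurable_one.indicator hE.compl).comp measurable_snd
  have hφI : ∀ z, φ z ∈ Set.Icc 0 1 := fun z => by
    by_cases h : z.2 ∈ E <;> simp [hφ, h]
  set e₀ : Fin 0 ↪ Fin M := ⟨Fin.elim0, fun a => a.elim0⟩ with he₀
  have hex : ∀ ω : Fin M → Ω, excess P φ ω e₀ = P.real E * M - (goodSet E ω).card := by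
    intro ω
    have h1 : ∫ x, φ (ω ∘ e₀, x) ∂P = 1 - P.real E := by
      simp only [hφ]
      rw [integral_indicator_one hE.compl, probReal_compl_eq_one_sub hE]
    have h2 : ∑ a, φ (ω ∘ e₀, ω a) = M - (goodSet E ω).card := by
      have h3 : ∀ a, φ (ω ∘ e₀, ω a) = 1 - if ω a ∈ E then (1 : ℝ) else 0 := by
        intro a
        by_cases h : ω a ∈ E <;> simp [hφ, h]
      simp only [h3]
      rw [Finset.sum_sub_distrib]
      simp [goodSet]
    have h4 : (Finset.univ.filter fun a => ∀ i, e₀ i ≠ a) = Finset.univ := by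
      ext a
      simp only [Finset.mem_filter, Finset.mem_univ, true_and, iff_true]
      exact fun i => i.elim0
    unfold excess
    rw [h4, Finset.sum_sub_distrib, h2, h1]
    simp
    ring
  set t : ℝ := (√M)⁻¹ with ht
  have ht0 : 0 < t := inv_pos.2 hsq
  have ht1 : t ≤ 1 := inv_le_one_of_one_le₀ hsq1
  have hexp := integral_exp_excess_le (D := P) hφm hφI e₀ ⟨ht0.le, ht1⟩
  have hMt : (M : ℝ) * t ^ 2 = 1 := by
    rw [ht, inv_pow, Real.sq_sqrt (by linarith), mul_inv_cancel₀ (by linarith)]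
  rw [hMt] at hexp
  have hmE : Measurable fun ω : Fin M → Ω => excess P φ ω e₀ := measurable_excess hφm e₀
  have hi : Integrable (fun ω : Fin M → Ω => Real.exp (t * excess P φ ω e₀))
      (Measure.pi fun _ : Fin M => P) :=
    integrable_of_mem_Icc' (hmE.const_mul t).exp (a := 0) (b := Real.exp (t * M)) fun ω =>
      ⟨(Real.exp_pos _).le, Real.exp_le_exp.2 (mul_le_mul_of_nonneg_left
        ((le_abs_self _).trans (abs_excess_le hφm hφI ω e₀)) ht0.le)⟩
  have hle : ∫ ω, max (m - (goodSet E ω).card) 0 ∂(Measure.pi fun _ : Fin M => P) ≤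
      ∫ ω, (√M * Real.exp (t * excess P φ ω e₀) + 1) ∂(Measure.pi fun _ : Fin M => P) := by
    refine integral_mono_of_nonneg (Filter.Eventually.of_forall fun ω => le_max_right _ _)
      ((hi.const_mul _).add (integrable_const _)) (Filter.Eventually.of_forall fun ω => ?_)
    have h1 := Real.add_one_le_exp (t * excess P φ ω e₀)
    have h2 : √M * (t * excess P φ ω e₀) = excess P φ ω e₀ := by
      rw [ht, mul_inv_cancel_left₀ hsq.ne']
    have h3 := mul_le_mul_of_nonneg_left h1 hsq.le
    have h4 := mul_pos hsq (Real.exp_pos (t * excess P φ ω e₀))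
    rw [mul_add, h2, hex ω] at h3
    simp only
    rw [hex ω] at h4 ⊢
    exact max_le (by linarith) (by linarith)
  rw [integral_add (hi.const_mul _) (integrable_const _), integral_const_mul] at hle
  have h3 : Real.exp 1 ≤ 3 := Real.exp_one_lt_three.le
  simp only [integral_const, probReal_univ, smul_eq_mul, mul_one] at hle
  nlinarith

end Easy

/-- The adaptive adversary simulates the oblivious one by deleting points outside the event on which
the oblivious adversary conditions, as far as its budget allows. -/
lemma integral_pi_le_adaptiveSubMax {X : Type u} [MeasurableSpace X] {M n m : ℕ} {η : ℝ}
    (hη0 : 0 < η) (hη : η < 1) {D D' : Measure X} (hD' : D' ∈ subDist η D) {f : (Fin n → X) → ℝ}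
    (hf : Measurable f) (hf01 : ∀ y, f y ∈ Set.Icc 0 1) (hM : 1 ≤ M)
    (hmdef : m = M - ⌊η * M⌋₊) (hnm : n ≤ m) (hm0 : 0 < m) :
    ∫ y, f y ∂(Measure.pi fun _ : Fin n => D') ≤ adaptiveSubMax η M f D + n * (4 * √M / m) := by
  classical
  obtain ⟨Ω, _, P, x, E, hP, hx, hE, rfl, hPE, rfl⟩ := hD'
  have hE0 : P E ≠ 0 := fun h0 => by
    rw [h0, nonpos_iff_eq_zero, ENNReal.ofReal_eq_zero] at hPE
    linarith
  have hPE' : 1 - η ≤ P.real E := by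
    rw [measureReal_def]
    exact (ENNReal.ofReal_le_iff_le_toReal (measure_ne_top _ _)).1 hPE
  have := cond_isProbabilityMeasure hE0
  have := Measure.isProbabilityMeasure_map (μ := P) hx.aemeasurable
  set Q := Measure.pi fun _ : Fin M => P with hQ
  set F := ∫ y, f y ∂(Measure.pi fun _ : Fin n => (P[|E]).map x) with hF
  set h : (Fin n → Ω) → ℝ := fun y => f (fun i => x (y i)) with hh
  have hxn : ∀ k : ℕ, Measurable fun y : Fin k → Ω => fun i => x (y i) := fun k => by fun_prop
  have hhm : Measurable h := hf.comp (hxn n)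
  have hFh : F = ∫ y, h y ∂(Measure.pi fun _ : Fin n => P[|E]) := by
    have h1 := Measure.pi_map_pi (μ := fun _ : Fin n => P[|E]) (f := fun _ => x)
      fun _ => hx.aemeasurable
    rw [hF, ← h1, integral_map (hxn n).aemeasurable hf.aestronglyMeasurable]
  have hF01 : F ∈ Set.Icc 0 1 := by
    rw [hFh]; exact integral_mem_Icc hhm fun y => hf01 _
  have hEn : MeasurableSet (Set.univ.pi fun _ : Fin n => E) := MeasurableSet.univ_pi fun _ => hE
  have hhi : Integrable h (Measure.pi fun _ : Fin n => P) :=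
    integrable_of_mem_Icc' hhm fun y => hf01 _
  -- the centered test function has mean zero on the event that all draws lie in `E`
  have hzero : ∫ y in Set.univ.pi fun _ => E, (h y - F) ∂(Measure.pi fun _ : Fin n => P) = 0 := by
    have hne : (Measure.pi fun _ : Fin n => P).real (Set.univ.pi fun _ => E) ≠ 0 := by
      rw [measureReal_def, Measure.pi_pi]
      simp [ENNReal.toReal_eq_zero_iff, hE0]
    have h1 : F = ((Measure.pi fun _ : Fin n => P).real (Set.univ.pi fun _ => E))⁻¹ *
        ∫ y in Set.univ.pi fun _ => E, h y ∂(Measure.pi fun _ : Fin n => P) := by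
      rw [hFh, pi_cond P hE hE0]
      unfold ProbabilityTheory.cond
      rw [integral_smul_measure, ENNReal.toReal_inv]
      rfl
    rw [integral_sub hhi.integrableOn (integrable_const _)]
    simp only [integral_const, measureReal_restrict_apply_univ, smul_eq_mul]
    have h2 : (Measure.pi fun _ : Fin n => P).real (Set.univ.pi fun _ => E) * F =
        ∫ y in Set.univ.pi fun _ => E, h y ∂(Measure.pi fun _ : Fin n => P) := by
      rw [h1, mul_inv_cancel_left₀ hne]
    linarith
  -- the points to keep, as a function of the set of points in `E`
  have hKex : ∀ g : Finset (Fin M), ∃ K : Finset (Fin M), g ⊆ K ∧ K.card = max g.card m := by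
    intro g
    obtain ⟨K, hK1, -, hK2⟩ := Finset.exists_subsuperset_card_eq (Finset.subset_univ g)
      (le_max_left g.card m) (by
        have h1 := Finset.card_le_univ g
        simp only [Finset.card_univ, Fintype.card_fin] at h1 ⊢
        omega)
    exact ⟨K, hK1, hK2⟩
  choose K hgK hKcard using hKex
  have hnK : ∀ g, n ≤ (K g).card := fun g => by rw [hKcard]; exact hnm.trans (le_max_right _ _)
  obtain ⟨C, hC, hCm, hCg⟩ := exists_kept_eq_adaptive (M := M) η hf
  have hadm : Measurable fun S : Fin M → X => embAvg (C S) n fun e => f (S ∘ e) :=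
    measurable_embAvg hC fun e => hf.comp (measurable_comp_embedding e)
  have hadI : ∀ S : Fin M → X, (embAvg (C S) n fun e => f (S ∘ e)) ∈ Set.Icc 0 1 := fun S =>
    embAvg_mem_Icc (hnm.trans (hmdef ▸ hCm S)) fun e => hf01 _
  have had : adaptiveSubMax η M f (P.map x) =
      ∫ ω, embAvg (C fun i => x (ω i)) n (fun e => f (fun i => x (ω (e i)))) ∂Q := by
    have h1 : adaptiveSubMax η M f (P.map x) =
        ∫ S, embAvg (C S) n (fun e => f (S ∘ e)) ∂(Measure.pi fun _ : Fin M => P.map x) :=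
      integral_congr_ae (Filter.Eventually.of_forall fun S => (hCg S).csSup_eq)
    have h2 := Measure.pi_map_pi (μ := fun _ : Fin M => P) (f := fun _ => x)
      fun _ => hx.aemeasurable
    rw [h1, ← h2, integral_map (hxn M).aemeasurable hadm.aestronglyMeasurable]
    rfl
  -- the contribution of injections into the set of points in `E`
  set T : (Fin M → Ω) → ℝ := fun ω => embAvg (K (goodSet E ω)) n
    (fun e => if ∀ i, e i ∈ goodSet E ω then h (ω ∘ e) - F else 0) with hT
  have hTsum : ∀ ω, T ω = ∑ g : Finset (Fin M), (goodSet E ⁻¹' {g}).indicator (fun ω =>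
      embAvg (K g) n (fun e => if ∀ i, e i ∈ g then h (ω ∘ e) - F else 0)) ω := by
    intro ω
    rw [Finset.sum_eq_single (goodSet E ω)]
    · simp [hT]
    · intro R _ hR
      exact Set.indicator_of_notMem (fun h => hR (by simpa using h.symm)) _
    · simp
  have hhem : ∀ e : Fin n ↪ Fin M, Measurable fun ω : Fin M → Ω => h (ω ∘ e) := fun e =>
    hhm.comp (measurable_comp_embedding e)
  have hem : ∀ (g : Finset (Fin M)) (e : Fin n ↪ Fin M), Measurable fun ω : Fin M → Ω =>
      if ∀ i, e i ∈ g then h (ω ∘ e) - F else 0 := by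
    intro g e
    split_ifs
    · exact (hhem e).sub_const F
    · exact measurable_const
  have hgm : ∀ g : Finset (Fin M), Measurable fun ω : Fin M → Ω =>
      embAvg (K g) n (fun e => if ∀ i, e i ∈ g then h (ω ∘ e) - F else 0) := by
    exact fun g => measurable_embAvg_const (K g) fun e => hem g e
  have hbnd : ∀ (ω : Fin M → Ω) (g : Finset (Fin M)) (e : Fin n ↪ Fin M),
      (if ∀ i, e i ∈ g then h (ω ∘ e) - F else 0) ∈ Set.Icc (-1 : ℝ) 1 := by
    intro ω g e
    have h1 := hf01 (fun i => x (ω (e i)))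
    have h2 : h (ω ∘ e) = f (fun i => x (ω (e i))) := rfl
    split_ifs
    · rw [h2]
      exact ⟨by linarith [h1.1, hF01.2], by linarith [h1.2, hF01.1]⟩
    · exact ⟨by norm_num, by norm_num⟩
  have hTm : Measurable T := by
    have : T = fun ω => ∑ g : Finset (Fin M), (goodSet E ⁻¹' {g}).indicator (fun ω =>
      embAvg (K g) n (fun e => if ∀ i, e i ∈ g then h (ω ∘ e) - F else 0)) ω := funext hTsum
    rw [this]
    exact Finset.measurable_sum _ fun g _ => (hgm g).indicator (measurableSet_goodSet_preimage hE g)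
  have hTi : Integrable T Q := integrable_of_mem_Icc' hTm fun ω =>
    embAvg_mem_Icc (hnK _) fun e => hbnd _ _ _
  have hT0 : ∫ ω, T ω ∂Q = 0 := by
    simp only [hTsum]
    rw [integral_finsetSum _ fun g _ => ((integrable_of_mem_Icc' (hgm g) fun ω =>
      embAvg_mem_Icc (hnK g) fun e => hbnd ω g e).indicator (measurableSet_goodSet_preimage hE g))]
    refine Finset.sum_eq_zero fun g _ => ?_
    rw [integral_indicator (measurableSet_goodSet_preimage hE g)]
    unfold embAvg
    rw [integral_const_mul, integral_finsetSum]
    · refine mul_eq_zero_of_right _ (Finset.sum_eq_zero fun e _ => ?_)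
      beta_reduce
      split_ifs with he
      · refine setIntegral_goodSet_eq_zero P hE (hhm.sub_const F) (b := 1) (fun y => ?_) hzero g _ he
        have h1 := hf01 (fun i => x (y i))
        exact ⟨by simp only [hh]; linarith [h1.1, hF01.2], by simp only [hh]; linarith [h1.2, hF01.1]⟩
      · simp
    · exact fun e _ => integrable_of_mem_Icc' (hem g _) fun ω => hbnd ω g _
  have hmR : (0 : ℝ) < m := by exact_mod_cast hm0
  have hpt : ∀ ω : Fin M → Ω, T ω + F ≤
      embAvg (C fun i => x (ω i)) n (fun e => f (fun i => x (ω (e i)))) +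
        n / m * max ((m : ℝ) - (goodSet E ω).card) 0 := by
    intro ω
    set g := goodSet E ω with hg
    have h1 : embAvg (K g) n (fun e => f (fun i => x (ω (e i)))) ≤
        embAvg (C fun i => x (ω i)) n (fun e => f (fun i => x (ω (e i)))) := by
      refine (hCg fun i => x (ω i)).2 ⟨removePoints _ (K g)ᶜ, ⟨(K g)ᶜ, ?_, rfl⟩, ?_⟩
      · have h2 := hKcard g
        have h3 := le_max_right g.card m
        rw [Finset.card_compl, Fintype.card_fin]
        omega
      · simp only [integral_subsamplingFilter_removePoints hf, compl_compl]
        rfl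
    have h2 : T ω + F * embAvg (K g) n (fun e => if ∀ i, e i ∈ g then 1 else 0) ≤
        embAvg (K g) n (fun e => f (fun i => x (ω (e i)))) := by
      simp only [hT]
      rw [← embAvg_const_mul, ← embAvg_add]
      refine embAvg_mono fun e _ => ?_
      by_cases he : ∀ i, e i ∈ g
      · simp only [← hg, if_pos he]
        have : h (ω ∘ e) = f (fun i => x (ω (e i))) := rfl
        linarith
      · simp only [← hg, if_neg he]
        have := (hf01 (fun i => x (ω (e i)))).1
        linarith
    have h3 := one_sub_le_embAvg_ite (hnK g) (hgK g)
    have h4 : ((K g).card - g.card : ℝ) / (K g).card ≤ max ((m : ℝ) - g.card) 0 / m := by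
      have h5 : ((K g).card : ℝ) = max (g.card : ℝ) m := by rw [hKcard]; push_cast; rfl
      have h6 : (m : ℝ) ≤ (K g).card := by rw [h5]; exact le_max_right _ _
      have h7 : ((K g).card : ℝ) - g.card = max ((m : ℝ) - g.card) 0 := by
        rw [h5]
        rcases le_total (g.card : ℝ) m with h | h
        · rw [max_eq_right h, max_eq_left (by linarith)]
        · rw [max_eq_left h, max_eq_right (by linarith)]; ring
      rw [h7]
      exact div_le_div_of_nonneg_left (le_max_right _ _) hmR h6
    have h5 : F * (1 - n * (max ((m : ℝ) - g.card) 0 / m)) ≤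
        F * embAvg (K g) n (fun e => if ∀ i, e i ∈ g then 1 else 0) := by
      refine mul_le_mul_of_nonneg_left (le_trans ?_ h3) hF01.1
      have := mul_le_mul_of_nonneg_left h4 (Nat.cast_nonneg (α := ℝ) n)
      linarith
    have h6 : F * (n * (max ((m : ℝ) - g.card) 0 / m)) ≤
        1 * (n * (max ((m : ℝ) - g.card) 0 / m)) :=
      mul_le_mul_of_nonneg_right hF01.2
        (mul_nonneg (Nat.cast_nonneg _) (div_nonneg (le_max_right _ _) hmR.le))
    have h7 : (n : ℝ) / m * max ((m : ℝ) - g.card) 0 = n * (max ((m : ℝ) - g.card) 0 / m) := by ring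
    rw [h7]
    linarith
  have hshort : ∫ ω, max ((m : ℝ) - (goodSet E ω).card) 0 ∂Q ≤ 4 * √M := by
    refine integral_shortfall_le hM P hE ?_
    have h1 := Nat.lt_floor_add_one (η * M)
    have h2 : (⌊η * M⌋₊ : ℝ) ≤ M := by
      refine (Nat.floor_le (by positivity)).trans ?_
      have : (0 : ℝ) ≤ M := by positivity
      nlinarith
    have h3 : (m : ℝ) = M - ⌊η * M⌋₊ := by
      rw [hmdef, Nat.cast_sub (by exact_mod_cast h2)]
    have h4 := mul_le_mul_of_nonneg_right hPE' (Nat.cast_nonneg (α := ℝ) M)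
    rw [h3]
    linarith
  have hai : Integrable (fun ω => embAvg (C fun i => x (ω i)) n
      (fun e => f (fun i => x (ω (e i))))) Q :=
    integrable_of_mem_Icc' (hadm.comp (hxn M)) fun ω => hadI _
  have hsm : Measurable fun ω : Fin M → Ω => ((goodSet E ω).card : ℝ) := by
    have : ∀ ω : Fin M → Ω, ((goodSet E ω).card : ℝ) = ∑ i, E.indicator (1 : Ω → ℝ) (ω i) := by
      intro ω
      simp [goodSet, Set.indicator_apply]
    simp only [this]
    exact Finset.measurable_sum _ fun i _ =>
      (measurable_one.indicator hE).comp (measurable_pi_apply i)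
  have hsi : Integrable (fun ω => max ((m : ℝ) - (goodSet E ω).card) 0) Q :=
    integrable_of_mem_Icc' ((hsm.const_sub _).max measurable_const) (a := 0) (b := m) fun ω =>
      ⟨le_max_right _ _, max_le (by linarith [Nat.cast_nonneg (α := ℝ) (goodSet E ω).card]) hmR.le⟩
  have hfin := integral_mono (hTi.add (integrable_const F)) (hai.add (hsi.const_mul _)) hpt
  simp only [Pi.add_apply] at hfin
  rw [integral_add hTi (integrable_const F), integral_add hai (hsi.const_mul _), hT0, ← had,
    integral_const_mul] at hfin
  simp only [integral_const, probReal_univ, smul_eq_mul, one_mul, zero_add] at hfin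
  have h8 : (n : ℝ) / m * ∫ ω, max ((m : ℝ) - (goodSet E ω).card) 0 ∂Q ≤ n / m * (4 * √M) := by
    gcongr
  have h9 : (n : ℝ) * (4 * √M / m) = n / m * (4 * √M) := by ring
  rw [h9]
  linarith

/-! ### The sample size -/

section SampleSize

variable {n M : ℕ} {c b : ℝ}

/-- The choice of the number `B` of blocks, and the resulting requirements on the sample size. With
`b = 1 / ε` the polynomial is the square of `1000 * (1 + n) ^ 4 * c ^ 3 * b ^ 3`, a multiple of the
lower bound on `√M` that makes the error of the core estimate at most `ε`. -/
lemma exists_blocks (hc : 1 ≤ c) (hb : 1 ≤ b)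
    (hM : 1000000 * (1 + (n : ℝ)) ^ 8 * b ^ 6 * c ^ 6 ≤ M) :
    1 ≤ M ∧ c * n ≤ M ∧ 4 * n * c * b ≤ √M ∧ ∃ B : ℕ, 0 < B ∧ 2 * c * (B * n) ≤ M ∧
      n * (4 * (2 * c * (3 * c * (B * n) + 1) / √M) + √(2 * c / B)) ≤ 1 / b := by
  have hc0 : 0 < c := by linarith
  have hb0 : 0 < b := by linarith
  have hn0 : (0 : ℝ) ≤ n := Nat.cast_nonneg n
  set a : ℝ := 1 + n with ha
  have ha1 : 1 ≤ a := by linarith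
  have hna : (n : ℝ) ≤ a := by linarith
  set U : ℝ := a ^ 4 * c ^ 3 * b ^ 3 with hU
  have hU1 : 1 ≤ U := by
    have h1 := one_le_pow₀ ha1 (n := 4)
    have h2 := one_le_pow₀ hc (n := 3)
    have h3 := one_le_pow₀ hb (n := 3)
    exact one_le_mul_of_one_le_of_one_le (one_le_mul_of_one_le_of_one_le h1 h2) h3
  have hs : 1000 * U ≤ √M := by
    refine Real.le_sqrt_of_sq_le (le_trans (le_of_eq ?_) hM)
    rw [hU]; ring
  have hs0 : 0 < √(M : ℝ) := by linarith
  have hss : √(M : ℝ) * √M = M := Real.mul_self_sqrt (Nat.cast_nonneg M)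
  have hsM : √(M : ℝ) ≤ M := by nlinarith
  have hncb : n * c * b ≤ U := by
    calc (n : ℝ) * c * b ≤ a ^ 4 * c ^ 3 * b ^ 3 := by
          gcongr
          · exact hna.trans (le_self_pow₀ ha1 (by norm_num))
          · exact le_self_pow₀ hc (by norm_num)
          · exact le_self_pow₀ hb (by norm_num)
      _ = U := rfl
  refine ⟨?_, ?_, by linarith, ⌈8 * c * n ^ 2 * b ^ 2⌉₊ + 1, Nat.succ_pos _, ?_⟩
  · have : (1 : ℝ) ≤ M := by linarith
    exact_mod_cast this
  · have : c * n ≤ n * c * b := by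
      rw [mul_comm c]; exact le_mul_of_one_le_right (by positivity) hb
    linarith
  set B : ℝ := ((⌈8 * c * n ^ 2 * b ^ 2⌉₊ + 1 : ℕ) : ℝ) with hB
  have hBl : 8 * c * n ^ 2 * b ^ 2 ≤ B := by
    rw [hB]; push_cast
    linarith [Nat.le_ceil (8 * c * n ^ 2 * b ^ 2)]
  have hB0 : 0 < B := by rw [hB]; positivity
  have hBu : B ≤ 10 * (c * a ^ 2 * b ^ 2) := by
    have h1 := (Nat.ceil_lt_add_one (show 0 ≤ 8 * c * (n : ℝ) ^ 2 * b ^ 2 by positivity)).le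
    have h2 : (1 : ℝ) ≤ c * a ^ 2 * b ^ 2 := one_le_mul_of_one_le_of_one_le
      (one_le_mul_of_one_le_of_one_le hc (one_le_pow₀ ha1)) (one_le_pow₀ hb)
    have h3 : c * (n : ℝ) ^ 2 * b ^ 2 ≤ c * a ^ 2 * b ^ 2 := by gcongr
    rw [hB]; push_cast
    linarith
  have hcN : c * (B * n) ≤ 10 * (c ^ 2 * a ^ 3 * b ^ 2) := by
    calc c * (B * n) ≤ c * (10 * (c * a ^ 2 * b ^ 2) * a) := by gcongr
      _ = _ := by ring
  have hW1 : 1 ≤ c ^ 2 * a ^ 3 * b ^ 2 := one_le_mul_of_one_le_of_one_le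
    (one_le_mul_of_one_le_of_one_le (one_le_pow₀ hc) (one_le_pow₀ ha1)) (one_le_pow₀ hb)
  have hWU : a * c * b * (c ^ 2 * a ^ 3 * b ^ 2) = U := by rw [hU]; ring
  refine ⟨?_, ?_⟩
  · have h1 : c ^ 2 * a ^ 3 * b ^ 2 ≤ U := by
      rw [← hWU]
      exact le_mul_of_one_le_left (by positivity)
        (one_le_mul_of_one_le_of_one_le (one_le_mul_of_one_le_of_one_le ha1 hc) hb)
    linarith
  · have h1 : n * (4 * (2 * c * (3 * c * (B * n) + 1) / √M)) ≤ 1 / (2 * b) := by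
      have h2 : n * c * b * (3 * c * (B * n) + 1) ≤ 31 * U := by
        calc n * c * b * (3 * c * (B * n) + 1) ≤ a * c * b * (31 * (c ^ 2 * a ^ 3 * b ^ 2)) := by
              gcongr
              linarith
          _ = 31 * U := by rw [← hWU]; ring
      have h3 : n * (4 * (2 * c * (3 * c * (B * n) + 1) / √M)) =
          8 * (n * c * (3 * c * (B * n) + 1)) / √M := by ring
      rw [h3, div_le_div_iff₀ hs0 (by positivity)]
      linarith
    have h2 : n * √(2 * c / B) ≤ 1 / (2 * b) := by
      rw [← sq_le_sq₀ (by positivity) (by positivity), mul_pow, Real.sq_sqrt (by positivity),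
        mul_div_assoc', div_pow, div_le_div_iff₀ hB0 (by positivity)]
      linarith
    have h3 : 1 / (2 * b) + 1 / (2 * b) = 1 / b := by field_simp; norm_num
    rw [mul_add]
    linarith

end SampleSize

theorem mainTheorem8 :
    ∃ p : MvPolynomial (Fin 3) ℝ,
      ∀ (X : Type u) [MeasurableSpace X] (D : Measure X) [IsProbabilityMeasure D]
        (n : ℕ) (f : (Fin n → X) → ℝ) (η ε : ℝ) (M : ℕ),
        Measurable f → (∀ S, f S = 0 ∨ f S = 1) →
        0 < η → η < 1 → 0 < ε → ε < 1 →
        MvPolynomial.eval ![(n : ℝ), 1 / ε, 1 / (1 - η)] p ≤ (M : ℝ) →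
          n + ⌊η * M⌋₊ ≤ M ∧
            |obliviousSubMax η f D - adaptiveSubMax η M f D| ≤ ε := by
  refine ⟨MvPolynomial.C 1000000 * (1 + MvPolynomial.X 0) ^ 8 * MvPolynomial.X 1 ^ 6 *
    MvPolynomial.X 2 ^ 6, ?_⟩
  intro X _ D _ n f η ε M hf hf01 hη0 hη1 hε0 hε1 hp
  simp only [map_mul, map_pow, map_add, map_one, MvPolynomial.eval_C, MvPolynomial.eval_X,
    Matrix.cons_val_zero, Matrix.cons_val_one, Matrix.cons_val] at hp
  have hfI : ∀ y, f y ∈ Set.Icc (0 : ℝ) 1 := fun y => by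
    rcases hf01 y with h | h <;> simp [h]
  have h1η : 0 < 1 - η := by linarith
  set c : ℝ := 1 / (1 - η) with hc
  have hc1 : 1 ≤ c := by rw [hc, le_div_iff₀ h1η]; linarith
  have hb1 : 1 ≤ 1 / ε := by rw [le_div_iff₀ hε0]; linarith
  obtain ⟨hM1, hcn, hs, B, hB, hBn, herr⟩ := exists_blocks hc1 hb1 hp
  rw [one_div_one_div] at herr
  have hMR : (1 : ℝ) ≤ M := by exact_mod_cast hM1
  set m := M - ⌊η * M⌋₊ with hm
  have hfl : (⌊η * M⌋₊ : ℝ) ≤ η * M := Nat.floor_le (by positivity)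
  have hfM : ⌊η * (M : ℝ)⌋₊ ≤ M := by
    have : (⌊η * M⌋₊ : ℝ) ≤ M := by nlinarith
    exact_mod_cast this
  have hmR : (m : ℝ) = M - ⌊η * M⌋₊ := by rw [hm, Nat.cast_sub hfM]
  have hMm : (M : ℝ) ≤ c * m := by
    rw [hc, div_mul_eq_mul_div, le_div_iff₀ h1η, hmR]
    linarith
  have hc0 : 0 < c := by linarith
  have hm0R : (0 : ℝ) < m := by
    by_contra h
    have : c * (m : ℝ) ≤ 0 := mul_nonpos_of_nonneg_of_nonpos hc0.le (not_lt.1 h)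
    linarith
  have hnm : n ≤ m := by
    have : (n : ℝ) ≤ m := le_of_mul_le_mul_left (hcn.trans hMm) hc0
    exact_mod_cast this
  have hMN : (M : ℝ) ≤ 2 * c * (m - B * n) := by linarith
  have hNm : B * n < m := by
    have : (0 : ℝ) < m - B * n := by
      by_contra h
      have := mul_nonpos_of_nonneg_of_nonpos (show 0 ≤ 2 * c by linarith) (not_lt.1 h)
      linarith
    have : ((B * n : ℕ) : ℝ) < m := by push_cast; linarith
    exact_mod_cast this
  refine ⟨by omega, abs_sub_le_iff.2 ⟨?_, ?_⟩⟩
  · rw [sub_le_iff_le_add']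
    have hone : (D.withDensity fun _ => ENNReal.ofReal 1) ∈ subDist η D :=
      withDensity_mem_subDist hη1 D measurable_const (fun _ => ⟨zero_le_one, hc1⟩) (by simp)
    refine csSup_le (Set.Nonempty.image _ ⟨_, hone⟩) ?_
    rintro _ ⟨D', hD', rfl⟩
    have h := integral_pi_le_adaptiveSubMax hη0 hη1 hD' hf hfI hM1 hm hnm (by exact_mod_cast hm0R)
    have hs0 : 0 < √(M : ℝ) := Real.sqrt_pos.2 (by linarith)
    have hss : √(M : ℝ) * √M = M := Real.mul_self_sqrt (by linarith)
    have h2 : (n : ℝ) * (4 * √M / m) ≤ ε := by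
      rw [mul_div_assoc', div_le_iff₀ hm0R]
      have h3 : 4 * n * c ≤ √M * ε := by
        have := mul_le_mul_of_nonneg_right hs hε0.le
        rwa [mul_assoc, one_div_mul_cancel hε0.ne', mul_one] at this
      have h4 : c * (n * (4 * √M)) ≤ c * (ε * m) := by
        calc c * (n * (4 * √M)) = 4 * n * c * √M := by ring
          _ ≤ √M * ε * √M := by gcongr
          _ = ε * M := by rw [mul_right_comm, hss, mul_comm]
          _ ≤ ε * (c * m) := by gcongr
          _ = c * (ε * m) := by ring
      exact le_of_mul_le_mul_left h4 hc0
    linarith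
  · rw [sub_le_iff_le_add']
    exact (adaptiveSubMax_le hη0 hη1 D hf hfI hc hB hm hNm hMm hMN).trans (by linarith)
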